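/- Let $a,b,\mathrm{Ha},\mathrm{Pm}>0$, $A=\mathrm{Ha}^2\,\mathrm{Pm}$, and let $\Omega=[0,\frac{2\pi}{a}]\times[0,\frac{2\pi}{b}]\times[-1,1]$; $(\cdot,\cdot)$ and $\|\cdot\|$ are the scalar product and norm of $L^2(\Omega)$. In the layer $\mathbb R^2\times[-1,1]$ consider the basic motions $\mathbf v=(U(z),0,0)$, $\hat{\mathbf B}=(\bar B(z),0,\mathrm{Rm}^{-1})$, where $\mathrm{Rm}=\mathrm{Pm}\,\mathrm{Re}$ and either (magnetic Couette) $$U=\frac{\sinh(\mathrm{Ha}\,z)}{\sinh \mathrm{Ha}},\qquad \bar B=\frac{\cosh\mathrm{Ha}-\cosh(\mathrm{Ha}\,z)}{\mathrm{Ha}\sinh\mathrm{Ha}},$$ or (Hartmann) $$U=\frac{\cosh\mathrm{Ha}-\cosh(\mathrm{Ha}\,z)}{\cosh\mathrm{Ha}-1},\qquad \bar B=\frac{\sinh(\mathrm{Ha}\,z)-z\sinh\mathrm{Ha}}{\mathrm{Ha}(\cosh\mathrm{Ha}-1)}.$$ A disturbance is a classical solution on $[0,\infty)$, with $\mathbf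 u=(u,v,w)$ and $\mathbf h=(h,k,\ell)$ of class $C^2$ on $\mathbb R^2\times[-1,1]\times[0,\infty)$ and the pressure $\bar\pi(\cdot,t)$ of class $C^1$ on the layer, of $$\mathbf u_t+U\mathbf u_x+wU'\mathbf i+\mathbf u\cdot\nabla\mathbf u=A\big[\bar B\mathbf h_x+\mathrm{Rm}^{-1}\mathbf h_z+\ell\bar B'\mathbf i+\mathbf h\cdot\nabla\mathbf h\big]-\nabla\bar\pi+\mathrm{Re}^{-1}\Delta\mathbf u,$$ $$\mathbf h_t+w\bar B'\mathbf i+U\mathbf h_x+\mathbf u\cdot\nabla\mathbf h-\bar B\mathbf u_x-\mathrm{Rm}^{-1}\mathbf u_z-\ell U'\mathbf i-\mathbf h\cdot\nabla\mathbf u=\mathrm{Rm}^{-1}\Delta\mathbf h,$$ $$\nabla\cdot\mathbf u=\nabla\cdot\mathbf h=0,$$ that is periodic in $x$ and $y$ with periods $2\pi/a$ and $2\pi/b$ and satisfies $\mathbf u=\mathbf h=0$ at $z=\pm1$. Its energy is $E(t)=\frac12(\|\mathbf u\|^2+A\|\mathbf h\|^2)$. Let $\mathcal S$ be the set of pairs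 $(\mathbf u,\mathbf h)$ of divergence-free vector fields, periodic in $x$ and $y$ as above, in $L^2(\Omega)$ together with their first weak derivatives, vanishing at $z=\pm1$ and not both zero. Put $$I=-(U'w,u)+A\big[(\ell\bar B',u)-(w\bar B',h)+(\ell U',h)\big],\qquad \mathcal D_1=\|\nabla u\|^2+\|\nabla w\|^2+\mathrm{Ha}^2\big(\|\nabla h\|^2+\|\nabla \ell\|^2\big).$$ For each of the two motions the supremum of $I/\mathcal D_1$ over the elements of $\mathcal S$ with $\mathcal D_1>0$ is finite and positive; call it $\mathrm{Re}_E^{-1}$. **Theorem.** If $0<\mathrm{Re}<\mathrm{Re}_E$, then the basic magnetic Couette and Hartmann motions are monotonically and asymptotically stable in the energy norm: for every disturbance, $E$ is differentiable on $[0,\infty)$ (one-sidedly at $0$), $\dot E(t)<0$ at every $t\ge0$ with $E(t)>0$, and $E(t)/E(0)\to0$ as $t\to\infty$ if $E(0)>0$. Explicitly, $$E(t)\le E(0)\,\exp\Big(\tfrac{\pi^2}{2}\,c_0\,(\mathrm{Re}-\mathrm{Re}_E)\,t\Big)\qquad(t\ge0),$$ where, for the given periodicity cell, the constant $c_0>0$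 depends only on $\mathrm{Ha}$ and $\mathrm{Pm}$ (not on $\mathrm{Re}$, the disturbance, or which of the two motions is considered). -/

import Mathlib

open Real Set Filter Topology MeasureTheory
open scoped ContDiff

noncomputable section

/-- Points `(x, y, z)`; the coordinates are `p 0`, `p 1`, `p 2`. Only components are ever
measured, so the norm carried by this type plays no role beyond its topology. -/
abbrev Pt : Type := Fin 3 → ℝ

/-- The two basic motions under study. -/
inductive BasicMotion : Type
  | couette : BasicMotion
  | hartmann : BasicMotion

/-- The velocity profile `U(z)`, the basic velocity being `(U(z), 0, 0)`. -/
def BasicMotion.U : BasicMotion → ℝ → ℝ → ℝ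
  | .couette, Ha, z => sinh (Ha * z) / sinh Ha
  | .hartmann, Ha, z => (cosh Ha - cosh (Ha * z)) / (cosh Ha - 1)

/-- The magnetic profile, the basic magnetic field being `(B(z), 0, 1 / Rm)`. -/
def BasicMotion.B : BasicMotion → ℝ → ℝ → ℝ
  | .couette, Ha, z => (cosh Ha - cosh (Ha * z)) / (Ha * sinh Ha)
  | .hartmann, Ha, z => (sinh (Ha * z) - z * sinh Ha) / (Ha * (cosh Ha - 1))

/-- The layer `ℝ² × [-1, 1]`. -/
def slab : Set Pt := {p | p 2 ∈ Icc (-1 : ℝ) 1}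

/-- The interior `ℝ² × (-1, 1)` of the layer. -/
def openSlab : Set Pt := {p | p 2 ∈ Ioo (-1 : ℝ) 1}

/-- The periodicity cell `[0, 2π/a] × [0, 2π/b] × [-1, 1]`. -/
def cell (a b : ℝ) : Set Pt := Icc ![0, 0, -1] ![2 * π / a, 2 * π / b, 1]

/-- Periodicity in `x` (period `2π/a`) and in `y` (period `2π/b`) on a set of points that is
invariant under horizontal translations. -/
def HorPeriodicOn {α : Type} (a b : ℝ) (f : Pt → α) (s : Set Pt) : Prop :=
  ∀ p ∈ s, f (p + Pi.single 0 (2 * π / a)) = f p ∧ f (p + Pi.single 1 (2 * π / b)) = f p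

/-- The partial derivative `∂f/∂x_j`. -/
def pd (j : Fin 3) (f : Pt → ℝ) (p : Pt) : ℝ := fderiv ℝ f p (Pi.single j 1)

/-- The three-dimensional Laplacian. -/
def lap (f : Pt → ℝ) (p : Pt) : ℝ := ∑ j, pd j (pd j f) p

/-! ### The disturbance equations -/

/-- `(u, h, q)` (velocity, magnetic field, pressure; first argument: time) is a classical
solution, on the time interval `[0, ∞)`, of the nonlinear system for the disturbances of the
basic motion `m`, with rigid and non-conducting walls, periodic in `x` and `y`. Here
`Rm = Pm * Re` and `A = Ha ^ 2 * Pm`; the component `0` is the direction of the basic flow. -/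
structure IsDisturbance (m : BasicMotion) (a b Ha Pm Re : ℝ)
    (u h : ℝ → Pt → Fin 3 → ℝ) (q : ℝ → Pt → ℝ) : Prop where
  smooth_u : ContDiffOn ℝ 2 (fun s : ℝ × Pt => u s.1 s.2) (Ici 0 ×ˢ slab)
  smooth_h : ContDiffOn ℝ 2 (fun s : ℝ × Pt => h s.1 s.2) (Ici 0 ×ˢ slab)
  smooth_q : ∀ t, 0 < t → ContDiffOn ℝ 1 (q t) slab
  periodic_u : ∀ t, 0 ≤ t → HorPeriodicOn a b (u t) slab
  periodic_h : ∀ t, 0 ≤ t → HorPeriodicOn a b (h t) slab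
  periodic_q : ∀ t, 0 < t → HorPeriodicOn a b (q t) slab
  rigid : ∀ t, 0 ≤ t → ∀ p : Pt, (p 2 = -1 ∨ p 2 = 1) → u t p = 0
  nonconducting : ∀ t, 0 ≤ t → ∀ p : Pt, (p 2 = -1 ∨ p 2 = 1) → h t p = 0
  momentum : ∀ t, 0 < t → ∀ p ∈ openSlab, ∀ i : Fin 3,
    deriv (fun s => u s p i) t
        + m.U Ha (p 2) * pd 0 (fun r => u t r i) p
        + u t p 2 * deriv (m.U Ha) (p 2) * (if i = 0 then 1 else 0)
        + ∑ j, u t p j * pd j (fun r => u t r i) p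
      = Ha ^ 2 * Pm *
          (m.B Ha (p 2) * pd 0 (fun r => h t r i) p
            + pd 2 (fun r => h t r i) p / (Pm * Re)
            + h t p 2 * deriv (m.B Ha) (p 2) * (if i = 0 then 1 else 0)
            + ∑ j, h t p j * pd j (fun r => h t r i) p)
        - pd i (q t) p
        + lap (fun r => u t r i) p / Re
  induction : ∀ t, 0 < t → ∀ p ∈ openSlab, ∀ i : Fin 3,
    deriv (fun s => h s p i) t
        + u t p 2 * deriv (m.B Ha) (p 2) * (if i = 0 then 1 else 0)
        + m.U Ha (p 2) * pd 0 (fun r => h t r i) p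
        + ∑ j, u t p j * pd j (fun r => h t r i) p
        - m.B Ha (p 2) * pd 0 (fun r => u t r i) p
        - pd 2 (fun r => u t r i) p / (Pm * Re)
        - h t p 2 * deriv (m.U Ha) (p 2) * (if i = 0 then 1 else 0)
        - ∑ j, h t p j * pd j (fun r => u t r i) p
      = lap (fun r => h t r i) p / (Pm * Re)
  div_u : ∀ t, 0 < t → ∀ p ∈ openSlab, ∑ i, pd i (fun r => u t r i) p = 0
  div_h : ∀ t, 0 < t → ∀ p ∈ openSlab, ∑ i, pd i (fun r => h t r i) p = 0

/-- The energy `E(t) = (‖u‖² + A ‖h‖²) / 2`, with `A = Ha ^ 2 * Pm` and the norms of `L²` of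
the periodicity cell. -/
def energy (a b Ha Pm : ℝ) (u h : ℝ → Pt → Fin 3 → ℝ) (t : ℝ) : ℝ :=
  1 / 2 * ((∫ p in cell a b, ∑ i, u t p i ^ 2)
    + Ha ^ 2 * Pm * ∫ p in cell a b, ∑ i, h t p i ^ 2)

/-! ### Kinematically admissible fields -/

/-- `g` is the weak gradient of `f` in the open layer. -/
def IsWeakGrad (f : Pt → ℝ) (g : Pt → Fin 3 → ℝ) : Prop :=
  ∀ φ : Pt → ℝ, ContDiff ℝ ∞ φ → HasCompactSupport φ → tsupport φ ⊆ openSlab →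
    ∀ j, ∫ p in openSlab, f p * pd j φ p = -∫ p in openSlab, g p j * φ p

/-- The trace of `f` (with weak gradient `g`) on the walls `z = ±1` is zero. For test functions
that need not vanish on the walls, Green's formula reads
`∫ f ∂_z φ + ∫ (∂_z f) φ = ∫_{z=1} f φ - ∫_{z=-1} f φ`; the trace vanishes if and only if the
right-hand side is zero for all of them. -/
def VanishesOnWalls (f : Pt → ℝ) (g : Pt → Fin 3 → ℝ) : Prop :=
  ∀ φ : Pt → ℝ, ContDiff ℝ ∞ φ → HasCompactSupport φ →
    ∫ p in openSlab, f p * pd 2 φ p = -∫ p in openSlab, g p 2 * φ p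

/-- The vector field `u` is periodic in `x` and `y`, is square integrable on the cell together
with its weak gradient `G` (`G p i j` is `∂u_i/∂x_j`), vanishes on the walls and is
divergence-free. -/
structure IsAdmissible (a b : ℝ) (u : Pt → Fin 3 → ℝ) (G : Pt → Fin 3 → Fin 3 → ℝ) : Prop where
  periodic : HorPeriodicOn a b u openSlab
  periodic_grad : HorPeriodicOn a b G openSlab
  memLp : ∀ i, MemLp (fun p => u p i) 2 (volume.restrict (cell a b))
  memLp_grad : ∀ i j, MemLp (fun p => G p i j) 2 (volume.restrict (cell a b))
  weakGrad : ∀ i, IsWeakGrad (fun p => u p i) (fun p => G p i)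
  walls : ∀ i, VanishesOnWalls (fun p => u p i) (fun p => G p i)
  div_free : ∀ᵐ p ∂(volume.restrict (cell a b)), ∑ i, G p i i = 0

/-- `I = -(U' w, u) + A [(ℓ B', u) - (w B', h) + (ℓ U', h)]`, for the velocity `(u, v, w)` and
the magnetic field `(h, k, ℓ)`, with `A = Ha ^ 2 * Pm`. -/
def production (m : BasicMotion) (a b Ha Pm : ℝ) (u h : Pt → Fin 3 → ℝ) : ℝ :=
  -(∫ p in cell a b, deriv (m.U Ha) (p 2) * u p 2 * u p 0)
    + Ha ^ 2 * Pm *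
      ((∫ p in cell a b, h p 2 * deriv (m.B Ha) (p 2) * u p 0)
        - (∫ p in cell a b, u p 2 * deriv (m.B Ha) (p 2) * h p 0)
        + ∫ p in cell a b, h p 2 * deriv (m.U Ha) (p 2) * h p 0)

/-- The square of the `L²` norm, over the cell, of the gradient of the `i`-th component. -/
def gradSq (a b : ℝ) (G : Pt → Fin 3 → Fin 3 → ℝ) (i : Fin 3) : ℝ :=
  ∫ p in cell a b, ∑ j, G p i j ^ 2

/-- `D₁ = ‖∇u‖² + ‖∇w‖² + Ha² (‖∇h‖² + ‖∇ℓ‖²)`. -/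
def dissipation₁ (a b Ha : ℝ) (Gu Gh : Pt → Fin 3 → Fin 3 → ℝ) : ℝ :=
  gradSq a b Gu 0 + gradSq a b Gu 2 + Ha ^ 2 * (gradSq a b Gh 0 + gradSq a b Gh 2)

/-- The values of `I / D₁` over the kinematically admissible fields with `D₁ > 0` (so that they
are automatically not both zero). -/
def energyRatios (m : BasicMotion) (a b Ha Pm : ℝ) : Set ℝ :=
  {r | ∃ u Gu h Gh, IsAdmissible a b u Gu ∧ IsAdmissible a b h Gh ∧
    0 < dissipation₁ a b Ha Gu Gh ∧
    r = production m a b Ha Pm u h / dissipation₁ a b Ha Gu Gh}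

/-- The critical Reynolds number `Re_E`: the inverse of the supremum of `I / D₁`. -/
def criticalRe (m : BasicMotion) (a b Ha Pm : ℝ) : ℝ :=
  (sSup (energyRatios m a b Ha Pm))⁻¹

end

/-! ### The layer and the periodicity cell -/

/-! This is the energy method. Take the scalar product of the momentum equation with u and of the
induction equation with A h, add, and integrate over the cell. Transport, pressure, the coupling
through the basic fields B and Rm⁻¹, and the Lorentz and stretching terms paired with each other are
all divergences; their integrals vanish by periodicity and the wall conditions. Since A / Rm = Ha² /
Re, what remains is E' = I − D / Re, where D = ‖∇u‖² + Ha² ‖∇h‖² is the full dissipation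
(`energy_balance`).

The production I involves only the components u, w, h, ℓ, so I ≤ D₁ / Re_E (`production_le`), and D₁
≤ D because the spanwise components only add dissipation. Hence E' ≤ −(1/Re − 1/Re_E) D. The gap
1/Re − 1/Re_E is at least (Re_E − Re) / Re_E², and the Poincaré inequality ‖f‖² ≤ 4 ‖∂_z f‖² gives D
≥ (μ/2) E with μ = min(1, 1/Pm) (`rate_le_of_energy_balance`). Gronwall's argument finishes
(`decay_of_hasDerivWithinAt`).

The supremum is taken over weakly differentiable fields, so Poincaré is proved for them by duality:
slide a test function upwards until it leaves the layer (`abs_integral_mul_test_le`), then use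
density of test functions. With bounded U' and B' this makes the supremum finite. It is positive
because a two-dimensional roll, tilted so that its Reynolds stress is correlated with U', extracts
energy from either motion (`exists_admissible_production_pos`). Classical disturbances are
admissible at each positive time by integration by parts (`isAdmissible_of_contDiffOn`). -/

theorem convex_slab : Convex ℝ slab :=
  (convex_Icc (-1 : ℝ) 1).linear_preimage (LinearMap.proj (R := ℝ) (φ := fun _ : Fin 3 => ℝ) 2)

theorem isOpen_openSlab : IsOpen openSlab :=
  isOpen_Ioo.preimage (continuous_apply 2)

theorem openSlab_subset_slab : openSlab ⊆ slab := fun _ hp => Ioo_subset_Icc_self hp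

theorem slab_mem_nhds {p : Pt} (hp : p ∈ openSlab) : slab ∈ 𝓝 p :=
  mem_of_superset (isOpen_openSlab.mem_nhds hp) openSlab_subset_slab

theorem uniqueDiffOn_slab : UniqueDiffOn ℝ slab := by
  refine uniqueDiffOn_convex convex_slab ⟨0, ?_⟩
  rw [mem_interior_iff_mem_nhds]
  exact slab_mem_nhds (by simp [openSlab])

open scoped Pointwise in
theorem vadd_slab {c : Pt} (hc : c 2 = 0) : c +ᵥ slab = slab := by
  ext p
  rw [Set.mem_vadd_set_iff_neg_vadd_mem]
  simp [slab, hc]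

theorem add_mem_openSlab {c p : Pt} (hc : c 2 = 0) (hp : p ∈ openSlab) : p + c ∈ openSlab := by
  simpa [openSlab, hc] using hp

theorem isCompact_cell (a b : ℝ) : IsCompact (cell a b) := isCompact_Icc

theorem cell_subset_slab (a b : ℝ) : cell a b ⊆ slab := fun p hp =>
  ⟨by simpa using hp.1 2, by simpa using hp.2 2⟩

/-- The interior of the periodicity cell. -/
def openCell (a b : ℝ) : Set Pt :=
  Set.pi univ fun i => Ioo ((![0, 0, -1] : Pt) i) ((![2 * π / a, 2 * π / b, 1] : Pt) i)

theorem openCell_ae_eq_cell (a b : ℝ) : openCell a b =ᵐ[volume] cell a b :=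
  Measure.univ_pi_Ioo_ae_eq_Icc

theorem isOpen_openCell (a b : ℝ) : IsOpen (openCell a b) :=
  isOpen_set_pi finite_univ fun _ _ => isOpen_Ioo

theorem openCell_subset_cell (a b : ℝ) : openCell a b ⊆ cell a b := fun _ hp =>
  ⟨fun i => (hp i trivial).1.le, fun i => (hp i trivial).2.le⟩

theorem openCell_subset_openSlab (a b : ℝ) : openCell a b ⊆ openSlab := fun p hp => by
  simpa [openSlab] using hp 2 trivial

theorem restrict_openCell (a b : ℝ) :
    (volume.restrict (openCell a b) : Measure Pt) = volume.restrict (cell a b) :=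
  Measure.restrict_congr_set (openCell_ae_eq_cell a b)

theorem ae_mem_openCell (a b : ℝ) : ∀ᵐ p ∂(volume.restrict (cell a b)), p ∈ openCell a b := by
  rw [← restrict_openCell]
  exact ae_restrict_mem (isOpen_openCell a b).measurableSet

theorem ae_mem_openSlab (a b : ℝ) : ∀ᵐ p ∂(volume.restrict (cell a b)), p ∈ openSlab :=
  (ae_mem_openCell a b).mono fun _ hp => openCell_subset_openSlab a b hp

theorem corners_le {a b : ℝ} (ha : 0 < a) (hb : 0 < b) :
    (![0, 0, -1] : Pt) ≤ ![2 * π / a, 2 * π / b, 1] := by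
  intro i
  fin_cases i
  · simp; positivity
  · simp; positivity
  · simp

theorem integrableOn_cell_of_continuousOn {a b : ℝ} {f : Pt → ℝ} (hf : ContinuousOn f slab) :
    IntegrableOn f (cell a b) :=
  (hf.mono (cell_subset_slab a b)).integrableOn_compact (isCompact_cell a b)

theorem memLp_cell_of_continuousOn {a b : ℝ} {f : Pt → ℝ} (hf : ContinuousOn f slab) :
    MemLp f 2 (volume.restrict (cell a b)) := by
  have hc := hf.mono (cell_subset_slab a b)
  obtain ⟨C, hC⟩ := (isCompact_cell a b).exists_bound_of_continuousOn hc
  have : IsFiniteMeasure ((volume : Measure Pt).restrict (cell a b)) :=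
    isFiniteMeasure_restrict.2 (isCompact_cell a b).measure_lt_top.ne
  exact MemLp.of_bound (hc.aestronglyMeasurable (isCompact_cell a b).measurableSet) C
    ((ae_restrict_mem (isCompact_cell a b).measurableSet).mono hC)

/-! ### Partial derivatives up to the walls -/

/-- The partial derivative `∂f/∂x_j` on the closed layer, one-sided on the walls. -/
noncomputable def pdSlab (j : Fin 3) (f : Pt → ℝ) (p : Pt) : ℝ :=
  fderivWithin ℝ f slab p (Pi.single j 1)

theorem pdSlab_eq_pd (j : Fin 3) (f : Pt → ℝ) {p : Pt} (hp : p ∈ openSlab) :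
    pdSlab j f p = pd j f p := by
  rw [pdSlab, pd, fderivWithin_of_mem_nhds (slab_mem_nhds hp)]

/-- On the walls `pd` sees the arbitrary values of `f` outside the layer, so it need not be
continuous there. Since the walls are null, integrals of `pd` can be handled through the continuous
function `pdSlab`. -/
theorem ae_pdSlab_eq_pd (a b : ℝ) (j : Fin 3) (f : Pt → ℝ) :
    pdSlab j f =ᵐ[volume.restrict (cell a b)] pd j f :=
  (ae_mem_openSlab a b).mono fun _ hp => pdSlab_eq_pd j f hp

theorem contDiffOn_pdSlab {m n : ℕ∞ω} {f : Pt → ℝ} (hf : ContDiffOn ℝ n f slab) (hmn : m + 1 ≤ n)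
    (j : Fin 3) : ContDiffOn ℝ m (pdSlab j f) slab :=
  (hf.fderivWithin uniqueDiffOn_slab hmn).clm_apply contDiffOn_const

theorem continuousOn_pdSlab {f : Pt → ℝ} (hf : ContDiffOn ℝ 1 f slab) (j : Fin 3) :
    ContinuousOn (pdSlab j f) slab :=
  (contDiffOn_pdSlab (m := 0) hf (by norm_num) j).continuousOn

/-- Horizontal translations preserve the layer, hence commute with differentiation within it. -/
theorem pdSlab_add_eq {f : Pt → ℝ} {c : Pt} (hc : c 2 = 0) (hf : ∀ p ∈ slab, f (p + c) = f p)
    (j : Fin 3) {p : Pt} (hp : p ∈ slab) : pdSlab j f (p + c) = pdSlab j f p := by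
  have h := fderivWithin_comp_add_right (𝕜 := ℝ) (f := f) (s := slab) (x := p) c
  rw [vadd_slab hc] at h
  rw [pdSlab, pdSlab, ← h]
  rw [fderivWithin_congr (fun q hq => hf q hq) (hf p hp)]

theorem pd_congr_slab {f g : Pt → ℝ} (h : EqOn f g openSlab) (j : Fin 3) {p : Pt}
    (hp : p ∈ openSlab) : pd j f p = pd j g p := by
  have : f =ᶠ[𝓝 p] g := h.eventuallyEq_of_mem (isOpen_openSlab.mem_nhds hp)
  rw [pd, pd, this.fderiv_eq]

theorem differentiableAt_of_contDiffOn_slab {f : Pt → ℝ} (hf : ContDiffOn ℝ 1 f slab) {p : Pt}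
    (hp : p ∈ openSlab) : DifferentiableAt ℝ f p :=
  (hf.contDiffAt (slab_mem_nhds hp)).differentiableAt (by norm_num)

theorem pd_mul {f g : Pt → ℝ} {p : Pt} (hf : DifferentiableAt ℝ f p) (hg : DifferentiableAt ℝ g p)
    (j : Fin 3) : pd j (fun r => f r * g r) p = f p * pd j g p + pd j f p * g p := by
  simp only [pd]
  rw [fderiv_fun_mul hf hg]
  simp [mul_comm]

theorem pd_add {f g : Pt → ℝ} {p : Pt} (hf : DifferentiableAt ℝ f p) (hg : DifferentiableAt ℝ g p)
    (j : Fin 3) : pd j (fun r => f r + g r) p = pd j f p + pd j g p := by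
  simp only [pd]
  rw [fderiv_fun_add hf hg]
  simp

theorem pd_comp_coord (V : ℝ → ℝ) (k : Fin 3) (p : Pt) (hV : DifferentiableAt ℝ V (p k))
    (j : Fin 3) : pd j (fun r => V (r k)) p = if k = j then deriv V (p k) else 0 := by
  have h1 : HasFDerivAt (fun r : Pt => r k)
    (ContinuousLinearMap.proj (R := ℝ) (φ := fun _ : Fin 3 => ℝ) k) p :=
    (ContinuousLinearMap.proj (R := ℝ) (φ := fun _ : Fin 3 => ℝ) k).hasFDerivAt
  have h2 := hV.hasDerivAt.comp_hasFDerivAt p h1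
  rw [pd, show (fun r : Pt => V (r k)) = V ∘ fun r => r k from rfl, h2.fderiv]
  simp [Pi.single_apply]

/-! ### The divergence theorem -/

/-- `f` is integrable over the periodicity cell, with integral zero. -/
def IntegralNull (a b : ℝ) (f : Pt → ℝ) : Prop :=
  IntegrableOn f (cell a b) ∧ ∫ p in cell a b, f p = 0

theorem IntegralNull.add {a b : ℝ} {f g : Pt → ℝ} (hf : IntegralNull a b f)
    (hg : IntegralNull a b g) : IntegralNull a b (fun p => f p + g p) :=
  ⟨hf.1.add hg.1, by rw [integral_add hf.1 hg.1, hf.2, hg.2, add_zero]⟩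

theorem IntegralNull.const_mul {a b : ℝ} {f : Pt → ℝ} (hf : IntegralNull a b f) (c : ℝ) :
    IntegralNull a b (fun p => c * f p) :=
  ⟨hf.1.const_mul c, by rw [integral_const_mul, hf.2, mul_zero]⟩

theorem IntegralNull.congr {a b : ℝ} {f g : Pt → ℝ} (hf : IntegralNull a b f)
    (h : ∀ p ∈ openSlab, f p = g p) : IntegralNull a b g := by
  have h' : f =ᵐ[volume.restrict (cell a b)] g := (ae_mem_openSlab a b).mono h
  exact ⟨hf.1.congr h', by rw [← integral_congr_ae h', hf.2]⟩

/-- Opposite lateral faces cancel by periodicity, and there is no flux through the walls. The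
divergence theorem needs differentiability only inside the cell and continuity up to its boundary.
-/
theorem integralNull_divergence {a b : ℝ} (ha : 0 < a) (hb : 0 < b) {F : Pt → Fin 3 → ℝ}
    (hF : ∀ i, ContDiffOn ℝ 1 (fun p => F p i) slab) (hper : HorPeriodicOn a b F slab)
    (hwall : ∀ p : Pt, (p 2 = -1 ∨ p 2 = 1) → F p 2 = 0) :
    IntegralNull a b (fun p => ∑ i, pd i (fun r => F r i) p) := by
  have hint : IntegrableOn (fun p => ∑ i, pd i (fun r => F r i) p) (cell a b) := by
    refine integrable_finsetSum _ fun i _ => ?_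
    exact (integrableOn_cell_of_continuousOn (continuousOn_pdSlab (hF i) i)).congr
      (ae_pdSlab_eq_pd a b i _)
  refine ⟨hint, ?_⟩
  have key := integral_divergence_of_hasFDerivAt_off_countable' (n := 2) (E := ℝ)
    ![0, 0, -1] ![2 * π / a, 2 * π / b, 1] (corners_le ha hb) (fun i p => F p i)
    (fun i p => fderiv ℝ (fun r => F r i) p) ∅ countable_empty
    (fun i => (hF i).continuousOn.mono (cell_subset_slab a b))
    (fun p hp i => (differentiableAt_of_contDiffOn_slab (hF i)
      (openCell_subset_openSlab a b (by simpa [openCell] using hp.1))).hasFDerivAt) hint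
  refine key.trans (Finset.sum_eq_zero fun i _ => ?_)
  rw [sub_eq_zero]
  refine setIntegral_congr_fun measurableSet_Icc fun x hx => ?_
  fin_cases i
  · have hs : (Fin.insertNth (0 : Fin 3) 0 x : Pt) ∈ slab := by
      have h1 := hx.1 1
      have h2 := hx.2 1
      simp at h1 h2
      exact ⟨h1, h2⟩
    have e : (Fin.insertNth (0 : Fin 3) (2 * π / a) x : Pt) =
        (Fin.insertNth (0 : Fin 3) 0 x : Pt) + Pi.single 0 (2 * π / a) := by
      ext k
      fin_cases k
      · simp [Fin.insertNth, Fin.succAboveCases]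
      · simp [Fin.insertNth, Fin.succAboveCases]
      · simp [Fin.insertNth, Fin.succAboveCases]
        rfl
    change F (Fin.insertNth (0 : Fin 3) (2 * π / a) x) 0 = F (Fin.insertNth (0 : Fin 3) 0 x) 0
    rw [e, (hper _ hs).1]
  · have hs : (Fin.insertNth (1 : Fin 3) 0 x : Pt) ∈ slab := by
      have h1 := hx.1 1
      have h2 := hx.2 1
      simp [Fin.succAbove] at h1 h2
      exact ⟨h1, h2⟩
    have e : (Fin.insertNth (1 : Fin 3) (2 * π / b) x : Pt) =
        (Fin.insertNth (1 : Fin 3) 0 x : Pt) + Pi.single 1 (2 * π / b) := by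
      ext k
      fin_cases k <;> simp [Fin.insertNth, Fin.succAboveCases]
    change F (Fin.insertNth (1 : Fin 3) (2 * π / b) x) 1 = F (Fin.insertNth (1 : Fin 3) 0 x) 1
    rw [e, (hper _ hs).2]
  · change F (Fin.insertNth (2 : Fin 3) 1 x) 2 = F (Fin.insertNth (2 : Fin 3) (-1) x) 2
    rw [hwall _ (Or.inr (by simp)), hwall _ (Or.inl (by simp))]

/-! ### Vanishing integrals -/

theorem HorPeriodicOn.comp {α β : Type} {a b : ℝ} {f : Pt → α} {s : Set Pt}
    (hf : HorPeriodicOn a b f s) (g : α → β) : HorPeriodicOn a b (fun p => g (f p)) s :=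
  fun p hp => ⟨congrArg g (hf p hp).1, congrArg g (hf p hp).2⟩

theorem HorPeriodicOn.prodMk {α β : Type} {a b : ℝ} {f : Pt → α} {g : Pt → β} {s : Set Pt}
    (hf : HorPeriodicOn a b f s) (hg : HorPeriodicOn a b g s) :
    HorPeriodicOn a b (fun p => (f p, g p)) s :=
  fun p hp => ⟨Prod.ext (hf p hp).1 (hg p hp).1, Prod.ext (hf p hp).2 (hg p hp).2⟩

theorem HorPeriodicOn.pi {ι α : Type} {a b : ℝ} {f : Pt → ι → α} {s : Set Pt}
    (hf : ∀ i, HorPeriodicOn a b (fun p => f p i) s) : HorPeriodicOn a b f s :=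
  fun p hp => ⟨funext fun i => (hf i p hp).1, funext fun i => (hf i p hp).2⟩

theorem HorPeriodicOn.mono {α : Type} {a b : ℝ} {f : Pt → α} {s t : Set Pt}
    (hf : HorPeriodicOn a b f s) (h : t ⊆ s) : HorPeriodicOn a b f t :=
  fun p hp => hf p (h hp)

theorem horPeriodicOn_of_coord {α : Type} (a b : ℝ) (V : ℝ → α) (s : Set Pt) :
    HorPeriodicOn a b (fun p => V (p 2)) s := fun p _ => by simp

theorem horPeriodicOn_const {α : Type} (a b : ℝ) (c : α) (s : Set Pt) :
    HorPeriodicOn a b (fun _ => c) s := fun _ _ => ⟨rfl, rfl⟩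

theorem HorPeriodicOn.pdSlab {a b : ℝ} {f : Pt → ℝ} (hf : HorPeriodicOn a b f slab) (j : Fin 3) :
    HorPeriodicOn a b (pdSlab j f) slab := fun p hp =>
  ⟨pdSlab_add_eq (by simp) (fun q hq => (hf q hq).1) j hp,
    pdSlab_add_eq (by simp) (fun q hq => (hf q hq).2) j hp⟩

theorem HorPeriodicOn.mul {a b : ℝ} {f g : Pt → ℝ} {s : Set Pt} (hf : HorPeriodicOn a b f s)
    (hg : HorPeriodicOn a b g s) : HorPeriodicOn a b (fun p => f p * g p) s :=
  (hf.prodMk hg).comp fun x => x.1 * x.2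

theorem contDiffOn_coord {V : ℝ → ℝ} {n : ℕ∞ω} (hV : ContDiff ℝ n V) :
    ContDiffOn ℝ n (fun p : Pt => V (p 2)) slab :=
  (hV.comp (contDiff_apply ℝ ℝ (2 : Fin 3))).contDiffOn


section

variable {a b : ℝ}

theorem integralNull_pd_of_periodic (ha : 0 < a) (hb : 0 < b) {f : Pt → ℝ}
    (hf : ContDiffOn ℝ 1 f slab) (hper : HorPeriodicOn a b f slab) :
    IntegralNull a b (pd 0 f) := by
  have := integralNull_divergence ha hb (F := fun p => ![f p, 0, 0])
    (fun i => by fin_cases i; exacts [hf, contDiffOn_const, contDiffOn_const])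
    (hper.comp fun y => ![y, 0, 0]) (fun p _ => rfl)
  refine this.congr fun p _ => ?_
  simp [Fin.sum_univ_three, pd]

/-- A profile depending on z alone passes under ∂_x, so no wall condition is needed. -/
theorem integralNull_coord_mul_pd (ha : 0 < a) (hb : 0 < b) {f : Pt → ℝ} {V : ℝ → ℝ}
    (hV : ContDiff ℝ 1 V) (hf : ContDiffOn ℝ 1 f slab) (hper : HorPeriodicOn a b f slab) :
    IntegralNull a b (fun p => V (p 2) * pd 0 f p) := by
  refine (integralNull_pd_of_periodic ha hb ((contDiffOn_coord hV).mul hf)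
    ((horPeriodicOn_of_coord a b V slab).mul hper)).congr fun p hp => ?_
  have hVd : DifferentiableAt ℝ V (p 2) := hV.differentiable (by norm_num) _
  rw [pd_mul (differentiableAt_of_contDiffOn_slab (contDiffOn_coord hV) hp)
    (differentiableAt_of_contDiffOn_slab hf hp), pd_comp_coord V 2 p hVd]
  simp

theorem integralNull_pd_of_walls (ha : 0 < a) (hb : 0 < b) {f : Pt → ℝ}
    (hf : ContDiffOn ℝ 1 f slab) (hper : HorPeriodicOn a b f slab)
    (hwall : ∀ p : Pt, (p 2 = -1 ∨ p 2 = 1) → f p = 0) :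
    IntegralNull a b (pd 2 f) := by
  have := integralNull_divergence ha hb (F := fun p => ![0, 0, f p])
    (fun i => by fin_cases i; exacts [contDiffOn_const, contDiffOn_const, hf])
    (hper.comp fun y => ![0, 0, y]) (fun p hp => hwall p hp)
  refine this.congr fun p _ => ?_
  simp [Fin.sum_univ_three, pd]

/-- For solenoidal v one has v · ∇f = div (f v). Only v has to vanish on the walls, so f may be the
pressure. -/
theorem integralNull_transport (ha : 0 < a) (hb : 0 < b) {v : Pt → Fin 3 → ℝ} {f : Pt → ℝ}
    (hv : ∀ i, ContDiffOn ℝ 1 (fun p => v p i) slab) (hvper : HorPeriodicOn a b v slab)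
    (hwall : ∀ p : Pt, (p 2 = -1 ∨ p 2 = 1) → v p = 0)
    (hdiv : ∀ p ∈ openSlab, ∑ i, pd i (fun r => v r i) p = 0)
    (hf : ContDiffOn ℝ 1 f slab) (hper : HorPeriodicOn a b f slab) :
    IntegralNull a b (fun p => ∑ j, v p j * pd j f p) := by
  have := integralNull_divergence ha hb (F := fun p i => v p i * f p)
    (fun i => (hv i).mul hf) (HorPeriodicOn.pi fun i => (hvper.comp fun y => y i).mul hper)
    (fun p hp => by simp [hwall p hp])
  refine this.congr fun p hp => ?_
  have e : ∀ i, pd i (fun r => v r i * f r) p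
      = v p i * pd i f p + pd i (fun r => v r i) p * f p := fun i =>
    pd_mul (differentiableAt_of_contDiffOn_slab (hv i) hp)
      (differentiableAt_of_contDiffOn_slab hf hp) i
  simp only [e, Finset.sum_add_distrib, ← Finset.sum_mul, hdiv p hp, zero_mul, add_zero]

/-- The integrand is div (f ∇f). The flux is written with `pdSlab`, so that it is C¹ up to the
walls. -/
theorem integralNull_green (ha : 0 < a) (hb : 0 < b) {f : Pt → ℝ}
    (hf : ContDiffOn ℝ 2 f slab) (hper : HorPeriodicOn a b f slab)
    (hwall : ∀ p : Pt, (p 2 = -1 ∨ p 2 = 1) → f p = 0) :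
    IntegralNull a b (fun p => f p * lap f p + ∑ j, pd j f p ^ 2) := by
  have hf1 : ContDiffOn ℝ 1 f slab := hf.of_le (by norm_num)
  have hd : ∀ j, ContDiffOn ℝ 1 (pdSlab j f) slab := fun j =>
    contDiffOn_pdSlab hf (by norm_num) j
  have := integralNull_divergence ha hb (F := fun p i => f p * pdSlab i f p)
    (fun i => hf1.mul (hd i)) (HorPeriodicOn.pi fun i => hper.mul (hper.pdSlab i))
    (fun p hp => by simp [hwall p hp])
  refine this.congr fun p hp => ?_
  rw [lap, Finset.mul_sum, ← Finset.sum_add_distrib]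
  refine Finset.sum_congr rfl fun i _ => ?_
  rw [pd_mul (differentiableAt_of_contDiffOn_slab hf1 hp)
    (differentiableAt_of_contDiffOn_slab (hd i) hp), pdSlab_eq_pd i f hp,
    pd_congr_slab (fun q hq => pdSlab_eq_pd i f hq) i hp]
  ring

/-! ### The Poincaré inequality for weakly differentiable fields -/

theorem inner_toLp_eq_integral {α : Type*} [MeasurableSpace α] {μ : Measure α} {f g : α → ℝ}
    (hf : MemLp f 2 μ) (hg : MemLp g 2 μ) :
    inner ℝ (hf.toLp f) (hg.toLp g) = ∫ x, f x * g x ∂μ := by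
  rw [L2.inner_def]
  refine integral_congr_ae ?_
  filter_upwards [hf.coeFn_toLp, hg.coeFn_toLp] with x h1 h2
  rw [h1, h2]
  simp [mul_comm]

theorem norm_toLp_eq_sqrt {α : Type*} [MeasurableSpace α] {μ : Measure α} {f : α → ℝ}
    (hf : MemLp f 2 μ) : ‖hf.toLp f‖ = √(∫ x, f x ^ 2 ∂μ) := by
  rw [norm_eq_sqrt_real_inner, inner_toLp_eq_integral hf hf]
  simp only [sq]

theorem abs_integral_mul_le_sqrt {α : Type*} [MeasurableSpace α] {μ : Measure α} {f g : α → ℝ}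
    (hf : MemLp f 2 μ) (hg : MemLp g 2 μ) :
    |∫ x, f x * g x ∂μ| ≤ √(∫ x, f x ^ 2 ∂μ) * √(∫ x, g x ^ 2 ∂μ) := by
  rw [← inner_toLp_eq_integral hf hg, ← norm_toLp_eq_sqrt hf, ← norm_toLp_eq_sqrt hg]
  exact abs_real_inner_le_norm _ _

/-- The upward unit vector. -/
def ez : Pt := Pi.single 2 1

theorem setIntegral_openSlab_eq_cell {h : Pt → ℝ}
    (hh : ∀ p ∈ openSlab, p ∉ openCell a b → h p = 0) :
    ∫ p in openSlab, h p = ∫ p in cell a b, h p := by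
  rw [← restrict_openCell]
  exact setIntegral_eq_of_subset_of_forall_sdiff_eq_zero isOpen_openSlab.measurableSet
    (openCell_subset_openSlab a b) fun p hp => hh p hp.1 hp.2

/-- A vertical shift of a support in the cell stays above the same rectangle: inside the layer it
never leaves the cell. This is why the Poincaré inequality on one cell needs no periodicity. -/
theorem mem_openCell_of_shift {p : Pt} {t : ℝ} (hp : p ∈ openSlab)
    (h : p - t • ez ∈ openCell a b) : p ∈ openCell a b := by
  have h0 := h 0 trivial
  have h1 := h 1 trivial
  simp [ez] at h0 h1
  intro i _
  fin_cases i
  · simpa using h0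
  · simpa using h1
  · simpa [openSlab] using hp

theorem pd_comp_sub (ψ : Pt → ℝ) (c p : Pt) (j : Fin 3) :
    pd j (fun q => ψ (q - c)) p = pd j ψ (p - c) := by
  simp only [pd, sub_eq_add_neg, fderiv_comp_add_right]

theorem pd_eq_zero_of_notMem_tsupport {ψ : Pt → ℝ} {p : Pt} (h : p ∉ tsupport ψ) (j : Fin 3) :
    pd j ψ p = 0 := by
  have : fderiv ℝ ψ p = 0 := by
    by_contra hne
    exact h (tsupport_fderiv_subset ℝ (subset_tsupport _ hne))
  simp [pd, this]

/-- Slide ψ upwards by t. The pairing with f then has derivative ∫ (∂_z f) ψ(· − t e_z), bounded by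
‖∂_z f‖ ‖ψ‖, and it is zero once the support has left the layer. The factor 2 is the height of the
layer. -/
theorem abs_integral_mul_test_le {f : Pt → ℝ} {g : Pt → Fin 3 → ℝ}
    (hf : MemLp f 2 (volume.restrict (cell a b)))
    (hg : MemLp (fun p => g p 2) 2 (volume.restrict (cell a b))) (hw : VanishesOnWalls f g)
    {ψ : Pt → ℝ} (hψ : ContDiff ℝ ∞ ψ) (hc : HasCompactSupport ψ)
    (hs : tsupport ψ ⊆ openCell a b) :
    |∫ p in cell a b, f p * ψ p| ≤
      2 * √(∫ p in cell a b, g p 2 ^ 2) * √(∫ p in cell a b, ψ p ^ 2) := by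
  have : IsFiniteMeasure ((volume : Measure Pt).restrict (cell a b)) :=
    isFiniteMeasure_restrict.2 (isCompact_cell a b).measure_lt_top.ne
  have hψc : Continuous ψ := hψ.continuous
  have hpdc : Continuous (pd 2 ψ) := (hψ.continuous_fderiv (by simp)).clm_apply continuous_const
  have hpds : ∀ p, p ∉ tsupport ψ → pd 2 ψ p = 0 := fun p h => pd_eq_zero_of_notMem_tsupport h 2
  have hpcs : HasCompactSupport (pd 2 ψ) := HasCompactSupport.intro hc hpds
  obtain ⟨C, hC⟩ := hpdc.bounded_above_of_compact_support hpcs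
  have hfi : Integrable f (volume.restrict (cell a b)) := hf.integrable (by norm_num)
  have hsh : ∀ t : ℝ, Continuous fun p : Pt => ψ (p - t • ez) := fun t => by fun_prop
  have hshL : ∀ t : ℝ, MemLp (fun p : Pt => ψ (p - t • ez)) 2 (volume.restrict (cell a b)) :=
    fun t => memLp_cell_of_continuousOn (hsh t).continuousOn
  have hder : ∀ t : ℝ, HasDerivAt (fun t : ℝ => ∫ p in cell a b, f p * ψ (p - t • ez))
      (∫ p in cell a b, g p 2 * ψ (p - t • ez)) t := by
    intro t
    -- The shifted test function may cross the upper wall, so the weak gradient alone would not do: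
    -- the zero trace is what removes the boundary term.
    have hval : ∫ p in cell a b, g p 2 * ψ (p - t • ez)
        = ∫ p in cell a b, f p * -pd 2 ψ (p - t • ez) := by
      have hcst : HasCompactSupport fun p : Pt => ψ (p - t • ez) :=
        hc.comp_homeomorph (Homeomorph.subRight (t • ez))
      have hw' := hw (fun p => ψ (p - t • ez)) (hψ.comp (contDiff_id.sub contDiff_const)) hcst
      rw [setIntegral_openSlab_eq_cell (a := a) (b := b),
        setIntegral_openSlab_eq_cell (a := a) (b := b)] at hw'
      · simp only [pd_comp_sub] at hw'
        simp only [mul_neg, integral_neg]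
        rw [hw', neg_neg]
      · intro p hp hnp
        have : p - t • ez ∉ tsupport ψ := fun h => hnp (mem_openCell_of_shift hp (hs h))
        rw [image_eq_zero_of_notMem_tsupport this, mul_zero]
      · intro p hp hnp
        have : p - t • ez ∉ tsupport ψ := fun h => hnp (mem_openCell_of_shift hp (hs h))
        rw [pd_comp_sub, hpds _ this, mul_zero]
    rw [hval]
    refine (hasDerivAt_integral_of_dominated_loc_of_deriv_le (bound := fun p => ‖f p‖ * C)
      (s := univ) (F := fun t p => f p * ψ (p - t • ez))
      (F' := fun t p => f p * -pd 2 ψ (p - t • ez)) univ_mem ?_ ?_ ?_ ?_ ?_ ?_).2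
    · exact Eventually.of_forall fun s => hfi.1.mul (hsh s).aestronglyMeasurable
    · exact hf.integrable_mul (hshL t)
    · exact hfi.1.mul
        (by fun_prop : Continuous fun p : Pt => -pd 2 ψ (p - t • ez)).aestronglyMeasurable
    · refine Eventually.of_forall fun p s _ => ?_
      rw [norm_mul, norm_neg]
      exact mul_le_mul_of_nonneg_left (hC _) (norm_nonneg _)
    · exact hfi.norm.mul_const C
    · refine Eventually.of_forall fun p s _ => ?_
      refine HasDerivAt.const_mul _ ?_
      have h1 : HasFDerivAt ψ (fderiv ℝ ψ (p - s • ez)) (p - s • ez) :=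
        (hψ.differentiable (by simp) _).hasFDerivAt
      have h2 : HasDerivAt (fun s : ℝ => p - s • ez) (-ez) s := by
        simpa using ((hasDerivAt_id s).smul_const ez).const_sub p
      have h3 := h1.comp_hasDerivAt s h2
      rw [map_neg] at h3
      exact h3
  have hψ2 : Integrable (fun p => ψ p ^ 2) := by
    refine (hψc.pow 2).integrable_of_hasCompactSupport ?_
    exact HasCompactSupport.intro hc fun p h => by simp [image_eq_zero_of_notMem_tsupport h]
  have hbound : ∀ t : ℝ, ‖∫ p in cell a b, g p 2 * ψ (p - t • ez)‖ ≤
      √(∫ p in cell a b, g p 2 ^ 2) * √(∫ p in cell a b, ψ p ^ 2) := by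
    intro t
    refine (abs_integral_mul_le_sqrt hg (hshL t)).trans ?_
    refine mul_le_mul_of_nonneg_left (Real.sqrt_le_sqrt ?_) (Real.sqrt_nonneg _)
    calc ∫ p in cell a b, ψ (p - t • ez) ^ 2
        ≤ ∫ p, ψ (p - t • ez) ^ 2 := by
          refine setIntegral_le_integral (hψ2.comp_sub_right _) ?_
          exact Eventually.of_forall fun p => sq_nonneg _
      _ = ∫ p, ψ p ^ 2 := integral_sub_right_eq_self (fun p => ψ p ^ 2) (t • ez)
      _ = ∫ p in cell a b, ψ p ^ 2 := by
          refine (setIntegral_eq_integral_of_forall_compl_eq_zero fun p hp => ?_).symm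
          have : p ∉ tsupport ψ := fun h => hp (openCell_subset_cell a b (hs h))
          simp [image_eq_zero_of_notMem_tsupport this]
  have hmv := norm_image_sub_le_of_norm_deriv_le_segment' (a := 0) (b := 2)
    (fun t _ => (hder t).hasDerivWithinAt) (fun t _ => hbound t) 2 (by norm_num)
  -- Points of the cell shifted down by 2 lie below the layer, where ψ vanishes.
  have h2 : ∫ p in cell a b, f p * ψ (p - (2 : ℝ) • ez) = 0 := by
    rw [← restrict_openCell]
    refine setIntegral_eq_zero_of_forall_eq_zero fun p hp => ?_
    have : p - (2 : ℝ) • ez ∉ tsupport ψ := fun h => by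
      have h3 := (openCell_subset_openSlab a b (hs h)).1
      have h4 := (openCell_subset_openSlab a b hp).2
      simp [ez] at h3
      linarith
    rw [image_eq_zero_of_notMem_tsupport this, mul_zero]
  rw [h2] at hmv
  simp only [zero_smul, sub_zero, zero_sub, norm_neg, Real.norm_eq_abs] at hmv
  linarith

/-- The test functions supported in the open set `U`, as a subspace of `L²(U)`. -/
def testSubmodule (U : Set Pt) : Submodule ℝ (Lp ℝ 2 ((volume : Measure Pt).restrict U)) where
  carrier := {x | ∃ ψ : Pt → ℝ, ContDiff ℝ ∞ ψ ∧ HasCompactSupport ψ ∧ tsupport ψ ⊆ U ∧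
    x =ᵐ[volume.restrict U] ψ}
  add_mem' := by
    rintro x y ⟨φ, h1, h2, h3, h4⟩ ⟨ψ, k1, k2, k3, k4⟩
    refine ⟨φ + ψ, h1.add k1, h2.add k2, (tsupport_add φ ψ).trans (union_subset h3 k3), ?_⟩
    exact (Lp.coeFn_add x y).trans (h4.add k4)
  zero_mem' := ⟨0, contDiff_const, HasCompactSupport.zero, by simp, Lp.coeFn_zero _ _ _⟩
  smul_mem' := by
    rintro c x ⟨φ, h1, h2, h3, h4⟩
    refine ⟨c • φ, contDiff_const.smul h1, h2.smul_left (f := fun _ => c), ?_, ?_⟩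
    · exact (tsupport_smul_subset_right (fun _ => c) φ).trans h3
    · exact (Lp.coeFn_smul c x).trans (h4.const_smul c)

/-- By the fundamental lemma of the calculus of variations, only zero is orthogonal to all test
functions. -/
theorem dense_testSubmodule {U : Set Pt} (hU : IsOpen U) (hfin : volume U ≠ ⊤) :
    (testSubmodule U).topologicalClosure = ⊤ := by
  have : IsFiniteMeasure ((volume : Measure Pt).restrict U) := isFiniteMeasure_restrict.2 hfin
  rw [Submodule.topologicalClosure_eq_top_iff, Submodule.eq_bot_iff]
  intro y hy
  have hyi : Integrable y (volume.restrict U) := (Lp.memLp y).integrable (by norm_num)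
  have key := hU.ae_eq_zero_of_integral_contDiff_smul_eq_zero (μ := volume.restrict U) (f := y)
    (hyi.locallyIntegrable.locallyIntegrableOn U) ?_
  · rw [Lp.eq_zero_iff_ae_eq_zero]
    filter_upwards [key, ae_restrict_mem hU.measurableSet] with p h1 h2 using h1 h2
  · intro ψ h1 h2 h3
    have hψL : MemLp ψ 2 (volume.restrict U) := h1.continuous.memLp_of_hasCompactSupport h2
    have := (Submodule.mem_orthogonal _ y).1 hy (hψL.toLp ψ) ⟨ψ, h1, h2, h3, hψL.coeFn_toLp⟩
    rw [L2.inner_def] at this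
    rw [← this]
    refine integral_congr_ae ?_
    filter_upwards [hψL.coeFn_toLp] with p hp
    rw [hp]
    simp [mul_comm]

/-- The bound on pairings with test functions is a closed condition, so by density it holds for the
pairing of f with itself; dividing by ‖f‖ gives ‖f‖ ≤ 2 ‖∂_z f‖. -/
theorem integral_sq_le_of_vanishesOnWalls {f : Pt → ℝ} {g : Pt → Fin 3 → ℝ}
    (hf : MemLp f 2 (volume.restrict (cell a b)))
    (hg : MemLp (fun p => g p 2) 2 (volume.restrict (cell a b))) (hw : VanishesOnWalls f g) :
    ∫ p in cell a b, f p ^ 2 ≤ 4 * ∫ p in cell a b, g p 2 ^ 2 := by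
  have htest : ∀ x ∈ testSubmodule (openCell a b),
      |inner ℝ ((restrict_openCell a b ▸ hf : MemLp f 2 (volume.restrict (openCell a b))).toLp f) x|
        ≤ 2 * √(∫ p in cell a b, g p 2 ^ 2) * ‖x‖ := by
    rintro x ⟨ψ, h1, h2, h3, h4⟩
    have hψL : MemLp ψ 2 (volume.restrict (openCell a b)) :=
      h1.continuous.memLp_of_hasCompactSupport h2
    have hx : x = hψL.toLp ψ := Lp.ext (h4.trans hψL.coeFn_toLp.symm)
    rw [hx, inner_toLp_eq_integral, norm_toLp_eq_sqrt, restrict_openCell]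
    exact abs_integral_mul_test_le hf hg hw h1 h2 h3
  set F := (restrict_openCell a b ▸ hf : MemLp f 2 (volume.restrict (openCell a b))).toLp f with hF
  have hclosed : IsClosed {x : Lp ℝ 2 ((volume : Measure Pt).restrict (openCell a b)) |
      |inner ℝ F x| ≤ 2 * √(∫ p in cell a b, g p 2 ^ 2) * ‖x‖} :=
    isClosed_le (by fun_prop) (by fun_prop)
  have hmem : F ∈ closure (testSubmodule (openCell a b) : Set _) := by
    have hfin : volume (openCell a b) ≠ ⊤ :=
      ((measure_mono (openCell_subset_cell a b)).trans_lt (isCompact_cell a b).measure_lt_top).ne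
    have := dense_testSubmodule (isOpen_openCell a b) hfin
    rw [← Submodule.topologicalClosure_coe, this]
    trivial
  have hFF : |inner ℝ F F| ≤ 2 * √(∫ p in cell a b, g p 2 ^ 2) * ‖F‖ :=
    closure_minimal (fun x hx => htest x hx) hclosed hmem
  have hnorm : ‖F‖ = √(∫ p in cell a b, f p ^ 2) := by
    rw [hF, norm_toLp_eq_sqrt, restrict_openCell]
  have h0 : 0 ≤ ∫ p in cell a b, f p ^ 2 := integral_nonneg fun p => sq_nonneg _
  have h1 : 0 ≤ ∫ p in cell a b, g p 2 ^ 2 := integral_nonneg fun p => sq_nonneg _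
  rw [real_inner_self_eq_norm_sq, abs_of_nonneg (sq_nonneg _), hnorm] at hFF
  have h2 := Real.sq_sqrt h0
  have h3 := Real.sq_sqrt h1
  have h4 : √(∫ p in cell a b, f p ^ 2) ≤ 2 * √(∫ p in cell a b, g p 2 ^ 2) := by
    rcases (Real.sqrt_nonneg (∫ p in cell a b, f p ^ 2)).eq_or_lt with h | h
    · rw [← h]; positivity
    · rw [sq] at hFF
      exact le_of_mul_le_mul_right hFF h
  nlinarith [Real.sqrt_nonneg (∫ p in cell a b, f p ^ 2),
    Real.sqrt_nonneg (∫ p in cell a b, g p 2 ^ 2)]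

/-! ### Classical fields are admissible -/

/-- Divergence theorem for the field g e_j, where g vanishes on every face of the box. -/
theorem integral_pd_box_eq_zero {g : Pt → ℝ} (hg : ContDiffOn ℝ 1 g slab) {R : ℝ} (hR : 0 ≤ R)
    (hwall : ∀ p : Pt, (p 2 = -1 ∨ p 2 = 1) → g p = 0)
    (hside : ∀ p : Pt, (|p 0| = R ∨ |p 1| = R) → g p = 0) (j : Fin 3) :
    ∫ p in Icc (![-R, -R, -1] : Pt) ![R, R, 1], pd j g p = 0 := by
  have hle : (![-R, -R, -1] : Pt) ≤ ![R, R, 1] := by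
    intro i
    fin_cases i
    · simp [hR]
    · simp [hR]
    · simp
  have hsub : Icc (![-R, -R, -1] : Pt) ![R, R, 1] ⊆ slab := fun p hp =>
    ⟨by simpa using hp.1 2, by simpa using hp.2 2⟩
  have hopen : ∀ p ∈ (Set.pi univ fun i => Ioo ((![-R, -R, -1] : Pt) i) ((![R, R, 1] : Pt) i)),
      p ∈ openSlab := fun p hp => by simpa [openSlab] using hp 2 trivial
  have hae : ∀ᵐ p ∂(volume.restrict (Icc (![-R, -R, -1] : Pt) ![R, R, 1])), p ∈ openSlab := by
    have := Measure.restrict_congr_set (μ := (volume : Measure Pt))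
      (Measure.univ_pi_Ioo_ae_eq_Icc (μ := fun _ : Fin 3 => (volume : Measure ℝ))
        (f := ![-R, -R, -1]) (g := ![R, R, 1]))
    rw [← this]
    exact (ae_restrict_mem (isOpen_set_pi finite_univ
      fun _ _ => isOpen_Ioo).measurableSet).mono hopen
  have hint : IntegrableOn (pd j g) (Icc (![-R, -R, -1] : Pt) ![R, R, 1]) :=
    (((continuousOn_pdSlab hg j).mono hsub).integrableOn_compact isCompact_Icc).congr
      (hae.mono fun p hp => pdSlab_eq_pd j g hp)
  have hsum : ∀ p, ∑ i, (if i = j then fderiv ℝ g p else 0) (Pi.single i 1) = pd j g p := by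
    intro p
    rw [Finset.sum_eq_single j]
    · simp [pd]
    · intro i _ hij
      simp [hij]
    · simp
  have key := integral_divergence_of_hasFDerivAt_off_countable' (n := 2) (E := ℝ)
    ![-R, -R, -1] ![R, R, 1] hle (fun i p => if i = j then g p else 0)
    (fun i p => if i = j then fderiv ℝ g p else 0) ∅ countable_empty
    (fun i => by
      split_ifs
      · exact hg.continuousOn.mono hsub
      · exact continuousOn_const)
    (fun p hp i => by
      split_ifs
      · exact (differentiableAt_of_contDiffOn_slab hg
          (hopen p (by simpa using hp.1))).hasFDerivAt
      · exact hasFDerivAt_const _ _)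
    (by simpa only [hsum] using hint)
  simp only [hsum] at key
  refine key.trans (Finset.sum_eq_zero fun i _ => ?_)
  have hz : ∀ x : Fin 2 → ℝ, g (i.insertNth ((![R, R, 1] : Pt) i) x) = 0 ∧
      g (i.insertNth ((![-R, -R, -1] : Pt) i) x) = 0 := by
    intro x
    fin_cases i
    · exact ⟨hside _ (Or.inl (by simp [abs_of_nonneg hR])),
        hside _ (Or.inl (by simp [abs_of_nonneg hR]))⟩
    · exact ⟨hside _ (Or.inr (by simp [abs_of_nonneg hR])),
        hside _ (Or.inr (by simp [abs_of_nonneg hR]))⟩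
    · exact ⟨hwall _ (Or.inr (by simp)), hwall _ (Or.inl (by simp))⟩
  simp [(hz _).1, (hz _).2]

/-- On a box wide enough to contain the support of φ horizontally, f φ vanishes on the walls because
of f and on the sides because of φ. Since φ is unrestricted at the walls, this gives both the weak
gradient and the zero trace. -/
theorem integral_mul_pd_eq_neg {f φ : Pt → ℝ} (hf : ContDiffOn ℝ 1 f slab)
    (hwall : ∀ p : Pt, (p 2 = -1 ∨ p 2 = 1) → f p = 0) (hφ : ContDiff ℝ ∞ φ)
    (hc : HasCompactSupport φ) (j : Fin 3) :
    ∫ p in openSlab, f p * pd j φ p = -∫ p in openSlab, pd j f p * φ p := by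
  obtain ⟨R, hR0, hR⟩ : ∃ R : ℝ, 0 < R ∧ ∀ p ∈ tsupport φ, ‖p‖ < R := by
    obtain ⟨R, hR⟩ := hc.isCompact.isBounded.exists_norm_le
    exact ⟨max R 0 + 1, by positivity, fun p hp =>
      ((hR p hp).trans (le_max_left R 0)).trans_lt (lt_add_one _)⟩
  have hφ1 : ContDiff ℝ 1 φ := hφ.of_le (by simp)
  set box : Set Pt := Icc (![-R, -R, -1] : Pt) ![R, R, 1] with hbox
  set obox : Set Pt := Set.pi univ fun i => Ioo ((![-R, -R, -1] : Pt) i) ((![R, R, 1] : Pt) i)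
    with hobox
  have hae : obox =ᵐ[volume] box := Measure.univ_pi_Ioo_ae_eq_Icc
  have hsub : obox ⊆ openSlab := fun p hp => by simpa [openSlab] using hp 2 trivial
  have hout : ∀ p ∈ openSlab \ obox, p ∉ tsupport φ := by
    rintro p ⟨hp, hnp⟩ hs
    refine hnp fun i _ => ?_
    have h0 := (norm_le_pi_norm p 0).trans_lt (hR p hs)
    have h1 := (norm_le_pi_norm p 1).trans_lt (hR p hs)
    rw [Real.norm_eq_abs, abs_lt] at h0 h1
    fin_cases i
    · exact h0
    · exact h1
    · simpa [openSlab] using hp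
  have hred : ∀ h : Pt → ℝ, (∀ p ∈ openSlab \ obox, h p = 0) →
      ∫ p in openSlab, h p = ∫ p in box, h p := by
    intro h hh
    rw [← Measure.restrict_congr_set hae]
    exact setIntegral_eq_of_subset_of_forall_sdiff_eq_zero isOpen_openSlab.measurableSet hsub hh
  rw [hred, hred]
  · have hbs : box ⊆ slab := fun p hp => ⟨by simpa using hp.1 2, by simpa using hp.2 2⟩
    have haeo : ∀ᵐ p ∂(volume.restrict box), p ∈ openSlab := by
      rw [← Measure.restrict_congr_set hae]
      exact (ae_restrict_mem (isOpen_set_pi finite_univ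
        fun _ _ => isOpen_Ioo).measurableSet).mono hsub
    have hz := integral_pd_box_eq_zero (hf.mul hφ1.contDiffOn) hR0.le
      (fun p hp => by simp [hwall p hp])
      (fun p hp => by
        have : p ∉ tsupport φ := fun hs => by
          have h0 := (norm_le_pi_norm p 0).trans_lt (hR p hs)
          have h1 := (norm_le_pi_norm p 1).trans_lt (hR p hs)
          rw [Real.norm_eq_abs] at h0 h1
          rcases hp with h | h <;> linarith
        simp [image_eq_zero_of_notMem_tsupport this]) j
    have e : ∫ p in box, pd j (fun r => f r * φ r) p
        = ∫ p in box, (f p * pd j φ p + pd j f p * φ p) := by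
      refine integral_congr_ae (haeo.mono fun p hp => ?_)
      exact pd_mul (differentiableAt_of_contDiffOn_slab hf hp)
        (hφ1.differentiable (by norm_num) p) j
    have i1 : IntegrableOn (fun p => f p * pd j φ p) box :=
      ((hf.continuousOn.mono hbs).mul
        ((hφ.continuous_fderiv (by simp)).clm_apply continuous_const).continuousOn)
        |>.integrableOn_compact isCompact_Icc
    have i2 : IntegrableOn (fun p => pd j f p * φ p) box :=
      ((((continuousOn_pdSlab hf j).mono hbs).mul hφ.continuous.continuousOn).integrableOn_compact
        isCompact_Icc).congr (haeo.mono fun p hp => by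
          simp only [Pi.mul_apply, pdSlab_eq_pd j f hp])
    have hz' : ∫ p in box, pd j (fun r => f r * φ r) p = 0 := hz
    rw [e, integral_add i1 i2] at hz'
    linarith
  · exact fun p hp => by rw [image_eq_zero_of_notMem_tsupport (hout p hp), mul_zero]
  · exact fun p hp => by rw [pd_eq_zero_of_notMem_tsupport (hout p hp), mul_zero]

theorem isAdmissible_of_contDiffOn {u : Pt → Fin 3 → ℝ}
    (hu : ∀ i, ContDiffOn ℝ 1 (fun p => u p i) slab) (hper : HorPeriodicOn a b u slab)
    (hwall : ∀ p : Pt, (p 2 = -1 ∨ p 2 = 1) → u p = 0)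
    (hdiv : ∀ p ∈ openSlab, ∑ i, pd i (fun r => u r i) p = 0) :
    IsAdmissible a b u (fun p i j => pd j (fun r => u r i) p) where
  periodic := hper.mono openSlab_subset_slab
  periodic_grad := by
    refine HorPeriodicOn.pi fun i => HorPeriodicOn.pi fun j => ?_
    have h := (HorPeriodicOn.pdSlab (hper.comp fun y => y i) j).mono openSlab_subset_slab
    intro p hp
    beta_reduce
    rw [← pdSlab_eq_pd _ _ hp, ← pdSlab_eq_pd _ _ (add_mem_openSlab (by simp) hp),
      ← pdSlab_eq_pd _ _ (add_mem_openSlab (by simp) hp)]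
    exact h p hp
  memLp i := memLp_cell_of_continuousOn (hu i).continuousOn
  memLp_grad i j := (memLp_cell_of_continuousOn (continuousOn_pdSlab (hu i) j)).ae_eq
    (ae_pdSlab_eq_pd a b j _)
  weakGrad i φ hφ hc _ j :=
    integral_mul_pd_eq_neg (hu i) (fun p hp => by simp [hwall p hp]) hφ hc j
  walls i φ hφ hc :=
    integral_mul_pd_eq_neg (hu i) (fun p hp => by simp [hwall p hp]) hφ hc 2
  div_free := (ae_mem_openSlab a b).mono hdiv

/-! ### Bounds for the production of energy -/

theorem BasicMotion.contDiff_U (m : BasicMotion) (Ha : ℝ) {n : ℕ∞ω} : ContDiff ℝ n (m.U Ha) := by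
  cases m
  · exact (contDiff_sinh.comp (contDiff_const.mul contDiff_id)).div_const _
  · exact (contDiff_const.sub (contDiff_cosh.comp (contDiff_const.mul contDiff_id))).div_const _

theorem BasicMotion.contDiff_B (m : BasicMotion) (Ha : ℝ) {n : ℕ∞ω} : ContDiff ℝ n (m.B Ha) := by
  cases m
  · exact (contDiff_const.sub (contDiff_cosh.comp (contDiff_const.mul contDiff_id))).div_const _
  · exact ((contDiff_sinh.comp (contDiff_const.mul contDiff_id)).sub
      (contDiff_id.mul contDiff_const)).div_const _

theorem contDiff_deriv_of_contDiff {V : ℝ → ℝ} (hV : ContDiff ℝ 2 V) : ContDiff ℝ 1 (deriv V) :=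
  ((contDiff_succ_iff_deriv (n := 1)).1 (by simpa [one_add_one_eq_two] using hV)).2.2

theorem gradSq_nonneg (a b : ℝ) (G : Pt → Fin 3 → Fin 3 → ℝ) (i : Fin 3) : 0 ≤ gradSq a b G i :=
  integral_nonneg fun _ => Finset.sum_nonneg fun _ _ => sq_nonneg _

theorem dissipation₁_nonneg (a b Ha : ℝ) (Gu Gh : Pt → Fin 3 → Fin 3 → ℝ) :
    0 ≤ dissipation₁ a b Ha Gu Gh := by
  have := gradSq_nonneg a b
  unfold dissipation₁
  have h1 := this Gu 0
  have h2 := this Gu 2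
  have h3 := this Gh 0
  have h4 := this Gh 2
  positivity

theorem IsAdmissible.integral_sq_le {u : Pt → Fin 3 → ℝ} {G : Pt → Fin 3 → Fin 3 → ℝ}
    (h : IsAdmissible a b u G) (i : Fin 3) :
    ∫ p in cell a b, u p i ^ 2 ≤ 4 * gradSq a b G i := by
  refine (integral_sq_le_of_vanishesOnWalls (h.memLp i) (h.memLp_grad i 2) (h.walls i)).trans ?_
  refine mul_le_mul_of_nonneg_left ?_ (by norm_num)
  refine integral_mono (h.memLp_grad i 2).integrable_sq
    (integrable_finsetSum _ fun j _ => (h.memLp_grad i j).integrable_sq) fun p => ?_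
  exact Finset.single_le_sum (f := fun j => G p i j ^ 2) (fun j _ => sq_nonneg _)
    (Finset.mem_univ 2)

theorem abs_integral_le_of_abs_le_mul {f g k : Pt → ℝ} {M : ℝ}
    (hf : MemLp f 2 (volume.restrict (cell a b))) (hg : MemLp g 2 (volume.restrict (cell a b)))
    (hM : 0 ≤ M) (hk : ∀ p ∈ slab, |k p| ≤ M * (|f p| * |g p|)) :
    |∫ p in cell a b, k p| ≤
      M * ((∫ p in cell a b, f p ^ 2) + ∫ p in cell a b, g p ^ 2) := by
  rw [← integral_add hf.integrable_sq hg.integrable_sq, ← integral_const_mul]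
  rw [← Real.norm_eq_abs]
  refine norm_integral_le_of_norm_le (((hf.integrable_sq.add hg.integrable_sq).const_mul M)) ?_
  refine (ae_mem_openSlab a b).mono fun p hp => ?_
  refine (hk p (openSlab_subset_slab hp)).trans (mul_le_mul_of_nonneg_left ?_ hM)
  change _ ≤ f p ^ 2 + g p ^ 2
  rw [← sq_abs (f p), ← sq_abs (g p)]
  nlinarith [sq_nonneg (|f p| - |g p|), sq_nonneg (|f p|), sq_nonneg (|g p|)]

/-- U' and B' are bounded on [-1, 1], and every factor in I is a component whose gradient enters D₁,
so Poincaré applies to each. -/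
theorem exists_abs_production_le (m : BasicMotion) (a b : ℝ) {Ha Pm : ℝ} (hHa : 0 < Ha)
    (hPm : 0 < Pm) : ∃ C : ℝ, ∀ u Gu h Gh, IsAdmissible a b u Gu → IsAdmissible a b h Gh →
      |production m a b Ha Pm u h| ≤ C * dissipation₁ a b Ha Gu Gh := by
  have hU : Continuous (deriv (m.U Ha)) :=
    (contDiff_deriv_of_contDiff (m.contDiff_U Ha)).continuous
  have hB : Continuous (deriv (m.B Ha)) :=
    (contDiff_deriv_of_contDiff (m.contDiff_B Ha)).continuous
  obtain ⟨M₁, hM₁⟩ := (isCompact_Icc (a := (-1 : ℝ)) (b := 1)).exists_bound_of_continuousOn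
    hU.continuousOn
  obtain ⟨M₂, hM₂⟩ := (isCompact_Icc (a := (-1 : ℝ)) (b := 1)).exists_bound_of_continuousOn
    hB.continuousOn
  set M := max (max M₁ M₂) 0 with hMdef
  have hM : 0 ≤ M := le_max_right _ _
  have hUM : ∀ p ∈ slab, |deriv (m.U Ha) (p 2)| ≤ M := fun p hp =>
    (hM₁ _ hp).trans ((le_max_left _ _).trans (le_max_left _ _))
  have hBM : ∀ p ∈ slab, |deriv (m.B Ha) (p 2)| ≤ M := fun p hp =>
    (hM₂ _ hp).trans ((le_max_right _ _).trans (le_max_left _ _))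
  -- A generous constant: the estimates only require 4M(1 + Ha² Pm) for the velocity gradients and
  -- 8M Pm for Ha² times the magnetic ones.
  refine ⟨M * (8 + 12 * Ha ^ 2 * Pm + (12 * Pm + 8)), fun u Gu h Gh hu hh => ?_⟩
  have b1 := abs_integral_le_of_abs_le_mul (a := a) (b := b) (hu.memLp 2) (hu.memLp 0) hM
    (k := fun p => deriv (m.U Ha) (p 2) * u p 2 * u p 0) (fun p hp => by
      rw [abs_mul, abs_mul, mul_assoc]
      exact mul_le_mul_of_nonneg_right (hUM p hp) (by positivity))
  have b2 := abs_integral_le_of_abs_le_mul (a := a) (b := b) (hh.memLp 2) (hu.memLp 0) hM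
    (k := fun p => h p 2 * deriv (m.B Ha) (p 2) * u p 0) (fun p hp => by
      rw [abs_mul, abs_mul, mul_comm |h p 2|, mul_assoc]
      exact mul_le_mul_of_nonneg_right (hBM p hp) (by positivity))
  have b3 := abs_integral_le_of_abs_le_mul (a := a) (b := b) (hu.memLp 2) (hh.memLp 0) hM
    (k := fun p => u p 2 * deriv (m.B Ha) (p 2) * h p 0) (fun p hp => by
      rw [abs_mul, abs_mul, mul_comm |u p 2|, mul_assoc]
      exact mul_le_mul_of_nonneg_right (hBM p hp) (by positivity))
  have b4 := abs_integral_le_of_abs_le_mul (a := a) (b := b) (hh.memLp 2) (hh.memLp 0) hM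
    (k := fun p => h p 2 * deriv (m.U Ha) (p 2) * h p 0) (fun p hp => by
      rw [abs_mul, abs_mul, mul_comm |h p 2|, mul_assoc]
      exact mul_le_mul_of_nonneg_right (hUM p hp) (by positivity))
  have q1 := hu.integral_sq_le 0
  have q2 := hu.integral_sq_le 2
  have q3 := hh.integral_sq_le 0
  have q4 := hh.integral_sq_le 2
  have n1 := gradSq_nonneg a b Gu 0
  have n2 := gradSq_nonneg a b Gu 2
  have n3 := gradSq_nonneg a b Gh 0
  have n4 := gradSq_nonneg a b Gh 2
  have hA : 0 < Ha ^ 2 * Pm := by positivity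
  unfold production dissipation₁
  set g1 := gradSq a b Gu 0
  set g2 := gradSq a b Gu 2
  set g3 := gradSq a b Gh 0
  set g4 := gradSq a b Gh 2
  set I1 := ∫ p in cell a b, deriv (m.U Ha) (p 2) * u p 2 * u p 0
  set I2 := ∫ p in cell a b, h p 2 * deriv (m.B Ha) (p 2) * u p 0
  set I3 := ∫ p in cell a b, u p 2 * deriv (m.B Ha) (p 2) * h p 0
  set I4 := ∫ p in cell a b, h p 2 * deriv (m.U Ha) (p 2) * h p 0
  have c1 : |I1| ≤ M * (4 * (g1 + g2)) := b1.trans (mul_le_mul_of_nonneg_left (by linarith) hM)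
  have c2 : |I2| ≤ M * (4 * (g1 + g4)) := b2.trans (mul_le_mul_of_nonneg_left (by linarith) hM)
  have c3 : |I3| ≤ M * (4 * (g2 + g3)) := b3.trans (mul_le_mul_of_nonneg_left (by linarith) hM)
  have c4 : |I4| ≤ M * (4 * (g3 + g4)) := b4.trans (mul_le_mul_of_nonneg_left (by linarith) hM)
  calc |(-I1 + Ha ^ 2 * Pm * (I2 - I3 + I4))|
      ≤ |I1| + Ha ^ 2 * Pm * (|I2| + |I3| + |I4|) := by
        refine (abs_add_le _ _).trans ?_
        rw [abs_neg, abs_mul, abs_of_pos hA]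
        have := (abs_add_le (I2 - I3) I4).trans (add_le_add_left (abs_sub I2 I3) _)
        gcongr
    _ ≤ M * (4 * (g1 + g2)) + Ha ^ 2 * Pm * (M * (4 * (g1 + g2 + 2 * (g3 + g4)))) := by
        gcongr
        linarith
    _ ≤ _ := by
        have e : M * (8 + 12 * Ha ^ 2 * Pm + (12 * Pm + 8)) * (g1 + g2 + Ha ^ 2 * (g3 + g4))
            - (M * (4 * (g1 + g2)) + Ha ^ 2 * Pm * (M * (4 * (g1 + g2 + 2 * (g3 + g4)))))
            = M * ((12 + 8 * Ha ^ 2 * Pm + 12 * Pm) * (g1 + g2)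
              + Ha ^ 2 * (16 + 12 * Ha ^ 2 * Pm + 4 * Pm) * (g3 + g4)) := by ring
        have : 0 ≤ M * ((12 + 8 * Ha ^ 2 * Pm + 12 * Pm) * (g1 + g2)
              + Ha ^ 2 * (16 + 12 * Ha ^ 2 * Pm + 4 * Pm) * (g3 + g4)) := by positivity
        linarith

/-! ### A two-dimensional roll that draws energy from the basic motion -/

/-- The velocity field with stream function `α(z) cos (ax) - γ(z) sin (ax)`, where `α₁` and `γ₁`
are the derivatives of `α` and `γ`. -/
noncomputable def rollField (a : ℝ) (α α₁ γ γ₁ : ℝ → ℝ) (p : Pt) : Fin 3 → ℝ :=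
  ![α₁ (p 2) * cos (a * p 0) + -γ₁ (p 2) * sin (a * p 0), 0,
    a * α (p 2) * sin (a * p 0) + a * γ (p 2) * cos (a * p 0)]

theorem cos_mul_add_period (ha : 0 < a) (x : ℝ) : cos (a * (x + 2 * π / a)) = cos (a * x) := by
  rw [show a * (x + 2 * π / a) = a * x + 2 * π by field_simp, cos_add_two_pi]

theorem sin_mul_add_period (ha : 0 < a) (x : ℝ) : sin (a * (x + 2 * π / a)) = sin (a * x) := by
  rw [show a * (x + 2 * π / a) = a * x + 2 * π by field_simp, sin_add_two_pi]

theorem horPeriodicOn_trig (ha : 0 < a) (s : Set Pt) :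
    HorPeriodicOn a b (fun p => (cos (a * p 0), sin (a * p 0), p 2)) s := fun p _ => by
  simp [cos_mul_add_period ha, sin_mul_add_period ha]

theorem hasDerivAt_cos_mul (a x : ℝ) : HasDerivAt (fun x => cos (a * x)) (-a * sin (a * x)) x := by
  have := (hasDerivAt_cos (a * x)).comp x ((hasDerivAt_id x).const_mul a)
  simpa [mul_comm, Function.comp_def] using this

theorem hasDerivAt_sin_mul (a x : ℝ) : HasDerivAt (fun x => sin (a * x)) (a * cos (a * x)) x := by
  have := (hasDerivAt_sin (a * x)).comp x ((hasDerivAt_id x).const_mul a)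
  simpa [mul_comm, Function.comp_def] using this

theorem pd_coord_mul_coord {V W : ℝ → ℝ} {V' W' : ℝ} {p : Pt} (hV : HasDerivAt V V' (p 2))
    (hW : HasDerivAt W W' (p 0)) :
    DifferentiableAt ℝ (fun r : Pt => V (r 2) * W (r 0)) p ∧
    pd 0 (fun r => V (r 2) * W (r 0)) p = V (p 2) * W' ∧
      pd 2 (fun r => V (r 2) * W (r 0)) p = V' * W (p 0) := by
  have dV : DifferentiableAt ℝ (fun r : Pt => V (r 2)) p :=
    hV.differentiableAt.comp p (differentiableAt_apply (𝕜 := ℝ) 2 p)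
  have dW : DifferentiableAt ℝ (fun r : Pt => W (r 0)) p :=
    hW.differentiableAt.comp p (differentiableAt_apply (𝕜 := ℝ) 0 p)
  refine ⟨dV.mul dW, ?_, ?_⟩
  · rw [pd_mul dV dW, pd_comp_coord V 2 p hV.differentiableAt,
      pd_comp_coord W 0 p hW.differentiableAt, hV.deriv, hW.deriv]
    simp
  · rw [pd_mul dV dW, pd_comp_coord V 2 p hV.differentiableAt,
      pd_comp_coord W 0 p hW.differentiableAt, hV.deriv, hW.deriv]
    simp

theorem isAdmissible_rollField (ha : 0 < a) {α α₁ γ γ₁ : ℝ → ℝ}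
    (hα : ContDiff ℝ 1 α) (hα₁ : ContDiff ℝ 1 α₁) (hγ : ContDiff ℝ 1 γ) (hγ₁ : ContDiff ℝ 1 γ₁)
    (dα : ∀ z, HasDerivAt α (α₁ z) z) (dγ : ∀ z, HasDerivAt γ (γ₁ z) z)
    (hwall : ∀ z, z = -1 ∨ z = 1 → α z = 0 ∧ α₁ z = 0 ∧ γ z = 0 ∧ γ₁ z = 0) :
    IsAdmissible a b (rollField a α α₁ γ γ₁)
      (fun p i j => pd j (fun r => rollField a α α₁ γ γ₁ r i) p) := by
  refine isAdmissible_of_contDiffOn ?_ ?_ ?_ ?_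
  · intro i
    refine ContDiff.contDiffOn ?_
    fin_cases i <;> simp only [rollField] <;> simp <;> fun_prop
  · exact (horPeriodicOn_trig ha slab).comp fun x =>
      ![α₁ x.2.2 * x.1 + -γ₁ x.2.2 * x.2.1, 0, a * α x.2.2 * x.2.1 + a * γ x.2.2 * x.1]
  · intro p hp
    obtain ⟨h1, h2, h3, h4⟩ := hwall _ hp
    simp only [rollField, h1, h2, h3, h4]
    ext i
    fin_cases i <;> simp
  · intro p _
    have d1 : HasDerivAt α₁ (deriv α₁ (p 2)) (p 2) :=
      (hα₁.differentiable (by norm_num) _).hasDerivAt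
    have d2 : HasDerivAt (fun z => -γ₁ z) (-deriv γ₁ (p 2)) (p 2) :=
      (hγ₁.differentiable (by norm_num) _).hasDerivAt.neg
    have e1 := pd_coord_mul_coord (p := p) d1 (hasDerivAt_cos_mul a (p 0))
    have e2 := pd_coord_mul_coord (p := p) d2 (hasDerivAt_sin_mul a (p 0))
    have e3 := pd_coord_mul_coord (p := p) ((dα (p 2)).const_mul a) (hasDerivAt_sin_mul a (p 0))
    have e4 := pd_coord_mul_coord (p := p) ((dγ (p 2)).const_mul a) (hasDerivAt_cos_mul a (p 0))
    rw [Fin.sum_univ_three]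
    simp only [rollField, Matrix.cons_val_zero, Matrix.cons_val_one, Matrix.cons_val]
    rw [pd_add e1.1 e2.1, pd_add e3.1 e4.1, e1.2.1, e2.2.1, e3.2.2, e4.2.2]
    simp [pd]
    ring

/-- The product of the two components is its mean in x, a (γ α₁ − α γ₁) / 2, plus second harmonics.
The latter are x-derivatives of sin² and sin · cos times functions of z, and integrate to zero. -/
theorem integral_mul_rollField (ha : 0 < a) (hb : 0 < b) {V α α₁ γ γ₁ : ℝ → ℝ}
    (hV : ContDiff ℝ 1 V)
    (hα : ContDiff ℝ 1 α) (hα₁ : ContDiff ℝ 1 α₁) (hγ : ContDiff ℝ 1 γ) (hγ₁ : ContDiff ℝ 1 γ₁) :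
    -∫ p in cell a b, V (p 2) * rollField a α α₁ γ γ₁ p 2 * rollField a α α₁ γ γ₁ p 0
      = ∫ p in cell a b, a / 2 * V (p 2) * (α (p 2) * γ₁ (p 2) - γ (p 2) * α₁ (p 2)) := by
  have hss : ContDiff ℝ 1 (fun p : Pt => sin (a * p 0) * sin (a * p 0)) := by fun_prop
  have hsc : ContDiff ℝ 1 (fun p : Pt => sin (a * p 0) * cos (a * p 0)) := by fun_prop
  have n1 := integralNull_coord_mul_pd ha hb
    (V := fun z => 1 / 2 * V z * (α z * α₁ z - γ z * γ₁ z)) (by fun_prop) hss.contDiffOn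
    ((horPeriodicOn_trig ha slab).comp fun x => x.2.1 * x.2.1)
  have n2 := integralNull_coord_mul_pd ha hb
    (V := fun z => 1 / 2 * V z * (α z * γ₁ z + γ z * α₁ z)) (by fun_prop) hsc.contDiffOn
    ((horPeriodicOn_trig ha slab).comp fun x => x.2.1 * x.1)
  have hint : IntegrableOn (fun p : Pt =>
      a / 2 * V (p 2) * (α (p 2) * γ₁ (p 2) - γ (p 2) * α₁ (p 2))) (cell a b) :=
    integrableOn_cell_of_continuousOn (Continuous.continuousOn (by fun_prop))
  have n3 := (n1.add n2).const_mul (-1)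
  rw [← integral_neg, ← add_zero (∫ p in cell a b, a / 2 * V (p 2) * _), ← n3.2,
    ← integral_add hint n3.1]
  refine integral_congr_ae (Eventually.of_forall fun p => ?_)
  have ds : DifferentiableAt ℝ (fun r : Pt => sin (a * r 0)) p := by fun_prop
  have dc : DifferentiableAt ℝ (fun r : Pt => cos (a * r 0)) p := by fun_prop
  have es : pd 0 (fun r => sin (a * r 0)) p = a * cos (a * p 0) := by
    have h := hasDerivAt_sin_mul a (p 0)
    rw [pd_comp_coord (fun x => sin (a * x)) 0 p h.differentiableAt, h.deriv, if_pos rfl]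
  have ec : pd 0 (fun r => cos (a * r 0)) p = -a * sin (a * p 0) := by
    have h := hasDerivAt_cos_mul a (p 0)
    rw [pd_comp_coord (fun x => cos (a * x)) 0 p h.differentiableAt, h.deriv, if_pos rfl]
  beta_reduce
  rw [pd_mul ds ds, pd_mul ds dc, es, ec]
  simp only [rollField, Matrix.cons_val_zero, Matrix.cons_val]
  have h := sin_sq_add_cos_sq (a * p 0)
  linear_combination (a / 2 * V (p 2) * (α (p 2) * γ₁ (p 2) - γ (p 2) * α₁ (p 2))) * h

/-- The Hartmann profile has U'(0) = 0; the upper half of the layer suffices for a positive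
integral. -/
theorem BasicMotion.deriv_U_ne_zero (m : BasicMotion) {Ha z : ℝ} (hHa : 0 < Ha) (hz : 0 < z) :
    deriv (m.U Ha) z ≠ 0 := by
  have hs : 0 < sinh Ha := sinh_pos_iff.2 hHa
  have hc : 1 < cosh Ha := one_lt_cosh.2 hHa.ne'
  cases m
  · have h : HasDerivAt (BasicMotion.couette.U Ha) (cosh (Ha * z) * (Ha * 1) / sinh Ha) z :=
      (((hasDerivAt_id z).const_mul Ha).sinh).div_const _
    rw [h.deriv]
    have := cosh_pos (Ha * z)
    positivity
  · have h : HasDerivAt (BasicMotion.hartmann.U Ha)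
        (-(sinh (Ha * z) * (Ha * 1)) / (cosh Ha - 1)) z :=
      ((((hasDerivAt_id z).const_mul Ha).cosh).const_sub _).div_const _
    rw [h.deriv]
    have : 0 < sinh (Ha * z) := sinh_pos_iff.2 (by positivity)
    have h2 : cosh Ha - 1 ≠ 0 := by linarith
    refine div_ne_zero (neg_ne_zero.2 ?_) h2
    positivity

/-- With zero magnetic field only −(U'w, u) survives. For γ = α U the Wronskian α γ' − γ α' equals
α² U', so the production is (a/2) ∫ (α U')². -/
theorem exists_admissible_production_pos (m : BasicMotion) (ha : 0 < a) (hb : 0 < b) {Ha : ℝ}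
    (hHa : 0 < Ha) (Pm : ℝ) : ∃ u Gu h Gh, IsAdmissible a b u Gu ∧ IsAdmissible a b h Gh ∧
      0 < production m a b Ha Pm u h := by
  set U := m.U Ha with hU
  -- Double zeros at z = ±1 make both α and α' vanish there, as the rigid walls demand.
  set α : ℝ → ℝ := fun z => (1 - z ^ 2) ^ 2 with hα
  set α₁ : ℝ → ℝ := fun z => -4 * z * (1 - z ^ 2) with hα₁
  have cU : ContDiff ℝ 1 U := m.contDiff_U Ha
  have cU' : ContDiff ℝ 1 (deriv U) := contDiff_deriv_of_contDiff (m.contDiff_U Ha)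
  have dU : ∀ z, HasDerivAt U (deriv U z) z := fun z =>
    (cU.differentiable (by norm_num) z).hasDerivAt
  have dα : ∀ z, HasDerivAt α (α₁ z) z := fun z => by
    have := (((hasDerivAt_id z).pow 2).const_sub 1).pow 2
    refine this.congr_deriv ?_
    simp [hα₁]
    ring
  have cα : ContDiff ℝ 1 α := by fun_prop
  have cα₁ : ContDiff ℝ 1 α₁ := by fun_prop
  have cγ : ContDiff ℝ 1 (fun z => α z * U z) := cα.mul cU
  have cγ₁ : ContDiff ℝ 1 (fun z => α₁ z * U z + α z * deriv U z) :=
    (cα₁.mul cU).add (cα.mul cU')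
  have had := isAdmissible_rollField (b := b) ha cα cα₁ cγ cγ₁ dα (fun z => (dα z).mul (dU z))
    (by rintro z (rfl | rfl) <;> simp [hα, hα₁])
  have hzero : IsAdmissible a b (fun _ => (0 : Fin 3 → ℝ)) _ :=
    isAdmissible_of_contDiffOn (fun i => contDiffOn_const) (horPeriodicOn_const a b _ _)
      (fun _ _ => rfl) (fun p _ => by simp [pd])
  refine ⟨_, _, _, _, had, hzero, ?_⟩
  rw [production, ← hU, integral_mul_rollField ha hb cU' cα cα₁ cγ cγ₁]
  simp only [Pi.zero_apply, zero_mul, mul_zero, integral_zero, sub_zero, add_zero]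
  have e : ∀ p : Pt, a / 2 * deriv U (p 2) *
      (α (p 2) * (α₁ (p 2) * U (p 2) + α (p 2) * deriv U (p 2)) - α (p 2) * U (p 2) * α₁ (p 2))
      = a / 2 * (α (p 2) * deriv U (p 2)) ^ 2 := fun p => by ring
  simp only [e]
  have hcont : Continuous fun p : Pt => a / 2 * (α (p 2) * deriv U (p 2)) ^ 2 := by
    have := cU'.continuous
    have := cα.continuous
    fun_prop
  rw [integral_pos_iff_support_of_nonneg (fun p => by positivity)
    (integrableOn_cell_of_continuousOn hcont.continuousOn)]
  set O : Set Pt := openCell a b ∩ {p | 0 < p 2} with hO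
  have hOo : IsOpen O := (isOpen_openCell a b).inter (isOpen_lt continuous_const (by fun_prop))
  have hOn : O.Nonempty := by
    refine ⟨![π / a, π / b, 1 / 2], fun i _ => ?_, by simp⟩
    have h1 : π / a < 2 * π / a := by gcongr; linarith [pi_pos]
    have h2 : π / b < 2 * π / b := by gcongr; linarith [pi_pos]
    have h3 : 0 < π / a := by positivity
    have h4 : 0 < π / b := by positivity
    fin_cases i
    · exact ⟨h3, h1⟩
    · exact ⟨h4, h2⟩
    · simp; norm_num
  have hpos : 0 < (volume.restrict (cell a b)) O := by
    rw [← restrict_openCell, Measure.restrict_apply hOo.measurableSet,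
      inter_eq_left.2 inter_subset_left]
    exact hOo.measure_pos volume hOn
  refine hpos.trans_le (measure_mono fun p hp => ?_)
  have h1 : deriv U (p 2) ≠ 0 := m.deriv_U_ne_zero hHa hp.2
  have h2 : α (p 2) ≠ 0 := by
    have := openCell_subset_openSlab a b hp.1
    have h3 : 0 < (1 - p 2) * (1 + p 2) :=
      mul_pos (by linarith [this.2]) (by linarith [this.1])
    simp only [hα]
    exact pow_ne_zero _ (by nlinarith)
  rw [Function.mem_support]
  positivity

theorem energyRatios_bounds (m : BasicMotion) (ha : 0 < a) (hb : 0 < b) {Ha Pm : ℝ}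
    (hHa : 0 < Ha) (hPm : 0 < Pm) :
    0 < criticalRe m a b Ha Pm ∧
      IsLUB (energyRatios m a b Ha Pm) (criticalRe m a b Ha Pm)⁻¹ := by
  obtain ⟨C, hC⟩ := exists_abs_production_le m a b hHa hPm
  obtain ⟨u, Gu, h, Gh, hu, hh, hpos⟩ := exists_admissible_production_pos m ha hb hHa Pm
  -- Positive production forces D₁ > 0, because |I| ≤ C D₁.
  have hD : 0 < dissipation₁ a b Ha Gu Gh := by
    refine (dissipation₁_nonneg a b Ha Gu Gh).lt_of_ne fun h0 => ?_
    have := hC u Gu h Gh hu hh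
    rw [← h0, mul_zero] at this
    linarith [le_abs_self (production m a b Ha Pm u h)]
  have hmem : production m a b Ha Pm u h / dissipation₁ a b Ha Gu Gh ∈ energyRatios m a b Ha Pm :=
    ⟨u, Gu, h, Gh, hu, hh, hD, rfl⟩
  have hbdd : BddAbove (energyRatios m a b Ha Pm) := by
    refine ⟨C, ?_⟩
    rintro r ⟨u, Gu, h, Gh, hu, hh, hD, rfl⟩
    rw [div_le_iff₀ hD]
    exact (le_abs_self _).trans (hC u Gu h Gh hu hh)
  have hlub := isLUB_csSup ⟨_, hmem⟩ hbdd
  rw [criticalRe, inv_inv]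
  exact ⟨inv_pos.2 ((div_pos hpos hD).trans_le (hlub.1 hmem)), hlub⟩

/-- The production of energy is controlled by `D₁`. -/
theorem production_le (m : BasicMotion) (ha : 0 < a) (hb : 0 < b) {Ha Pm : ℝ}
    (hHa : 0 < Ha) (hPm : 0 < Pm) {u h : Pt → Fin 3 → ℝ} {Gu Gh : Pt → Fin 3 → Fin 3 → ℝ}
    (hu : IsAdmissible a b u Gu) (hh : IsAdmissible a b h Gh) :
    production m a b Ha Pm u h ≤ (criticalRe m a b Ha Pm)⁻¹ * dissipation₁ a b Ha Gu Gh := by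
  -- Fields with D₁ = 0 are not seen by the supremum; for them |I| ≤ C D₁ gives I = 0.
  rcases (dissipation₁_nonneg a b Ha Gu Gh).eq_or_lt with h0 | h0
  · obtain ⟨C, hC⟩ := exists_abs_production_le m a b hHa hPm
    have := hC u Gu h Gh hu hh
    rw [← h0, mul_zero] at this ⊢
    exact (le_abs_self _).trans this
  · rw [← div_le_iff₀ h0]
    exact (energyRatios_bounds m ha hb hHa hPm).2.1 ⟨u, Gu, h, Gh, hu, hh, h0, rfl⟩

/-! ### Differentiation in time of integrals over the cell -/

/-- Projection of a space-time point to the domain `[0, ∞) × layer`. -/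
def clampDomain (x : ℝ × Pt) : ℝ × Pt :=
  (max x.1 0, fun i => if i = 2 then max (-1) (min 1 (x.2 i)) else x.2 i)

theorem continuous_clampDomain : Continuous clampDomain := by
  refine (continuous_fst.max continuous_const).prodMk (continuous_pi fun i => ?_)
  split_ifs <;> fun_prop

theorem clampDomain_mem (x : ℝ × Pt) : clampDomain x ∈ Ici (0 : ℝ) ×ˢ slab :=
  ⟨mem_Ici.2 (le_max_right x.1 0), by simp [clampDomain, slab]⟩

theorem clampDomain_of_mem {t : ℝ} {p : Pt} (ht : 0 ≤ t) (hp : p ∈ slab) :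
    clampDomain (t, p) = (t, p) := by
  refine Prod.ext (max_eq_left ht) (funext fun i => ?_)
  simp only [clampDomain]
  split_ifs with h
  · subst h
    rw [min_eq_right hp.2, max_eq_right hp.1]
  · rfl

theorem uniqueDiffOn_domain : UniqueDiffOn ℝ (Ici (0 : ℝ) ×ˢ slab) :=
  (uniqueDiffOn_Ici 0).prod uniqueDiffOn_slab

theorem hasDerivWithinAt_time {f : ℝ × Pt → ℝ} (hf : ContDiffOn ℝ 1 f (Ici (0 : ℝ) ×ˢ slab))
    {t : ℝ} (ht : 0 ≤ t) {p : Pt} (hp : p ∈ slab) :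
    HasDerivWithinAt (fun s => f (s, p))
      (fderivWithin ℝ f (Ici (0 : ℝ) ×ˢ slab) (t, p) (1, 0)) (Ici 0) t := by
  have h1 := (hf.differentiableOn (by norm_num) (t, p) ⟨ht, hp⟩).hasFDerivWithinAt
  have h2 : HasDerivWithinAt (fun s : ℝ => (s, p)) ((1, 0) : ℝ × Pt) (Ici 0) t :=
    (hasDerivWithinAt_id t _).prodMk (hasDerivWithinAt_const t _ p)
  have h3 : MapsTo (fun s : ℝ => (s, p)) (Ici 0) (Ici (0 : ℝ) ×ˢ slab) := fun s hs => ⟨hs, hp⟩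
  exact h1.comp_hasDerivWithinAt t h2 h3

/-- The fundamental theorem of calculus in time and Fubini write the integral as a primitive of a
continuous F, which includes the one-sided derivative at 0. F is identified through `deriv` only for
t > 0, since at 0 `deriv` would involve negative times. -/
theorem exists_hasDerivWithinAt_integral_cell {f : ℝ × Pt → ℝ}
    (hf : ContDiffOn ℝ 1 f (Ici (0 : ℝ) ×ˢ slab)) (a b : ℝ) :
    ∃ F : ℝ → ℝ, Continuous F ∧
      (∀ t, 0 ≤ t → HasDerivWithinAt (fun t => ∫ p in cell a b, f (t, p)) (F t) (Ici 0) t) ∧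
      ∀ t, 0 < t → F t = ∫ p in cell a b, deriv (fun s => f (s, p)) t := by
  set f' : ℝ × Pt → ℝ := fun x => fderivWithin ℝ f (Ici (0 : ℝ) ×ˢ slab) x (1, 0) with hf'
  have hf'c : ContinuousOn f' (Ici (0 : ℝ) ×ˢ slab) :=
    (hf.continuousOn_fderivWithin uniqueDiffOn_domain (by norm_num)).clm_apply continuousOn_const
  -- Clamping extends the time derivative to a jointly continuous function on all of space-time.
  set g : ℝ → Pt → ℝ := fun t p => f' (clampDomain (t, p)) with hg
  have hgc : Continuous (Function.uncurry g) :=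
    hf'c.comp_continuous continuous_clampDomain clampDomain_mem
  have hF : Continuous fun t => ∫ p in cell a b, g t p :=
    continuous_parametric_integral_of_continuous hgc (isCompact_cell a b)
  have hgf : ∀ {t : ℝ} {p : Pt}, 0 ≤ t → p ∈ slab → g t p = f' (t, p) := fun ht hp => by
    simp only [hg, clampDomain_of_mem ht hp]
  have hcell : MeasurableSet (cell a b) := (isCompact_cell a b).measurableSet
  have hfc : ∀ t, 0 ≤ t → IntegrableOn (fun p => f (t, p)) (cell a b) := fun t ht =>
    integrableOn_cell_of_continuousOn
      (hf.continuousOn.comp (Continuous.continuousOn (by fun_prop)) fun p hp => ⟨ht, hp⟩)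
  have hftc : ∀ t, 0 ≤ t → ∫ p in cell a b, f (t, p) =
      (∫ p in cell a b, f (0, p)) + ∫ s in (0 : ℝ)..t, ∫ p in cell a b, g s p := by
    intro t ht
    have hswap : ∫ s in (0 : ℝ)..t, ∫ p in cell a b, g s p
        = ∫ p in cell a b, ∫ s in (0 : ℝ)..t, g s p := by
      refine intervalIntegral_integral_swap ?_
      rw [Measure.prod_restrict]
      refine IntegrableOn.mono_set (t := uIcc 0 t ×ˢ cell a b) ?_
        (prod_mono uIoc_subset_uIcc subset_rfl)
      exact hgc.continuousOn.integrableOn_compact (isCompact_uIcc.prod (isCompact_cell a b))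
    rw [hswap, ← sub_eq_iff_eq_add', ← integral_sub (hfc t ht) (hfc 0 le_rfl)]
    refine setIntegral_congr_fun hcell fun p hp => ?_
    have hps := cell_subset_slab a b hp
    refine (intervalIntegral.integral_eq_sub_of_hasDerivAt_of_le (f := fun s => f (s, p)) ht
      ?_ ?_ ?_).symm
    · exact fun s hs => ((hasDerivWithinAt_time hf hs.1 hps).continuousWithinAt).mono
        fun r hr => hr.1
    · intro s hs
      rw [hgf hs.1.le hps]
      exact (hasDerivWithinAt_time hf hs.1.le hps).hasDerivAt (Ici_mem_nhds hs.1)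
    · exact Continuous.intervalIntegrable (hgc.comp (by fun_prop : Continuous fun s => (s, p))) _ _
  refine ⟨_, hF, fun t ht => ?_, fun t ht => ?_⟩
  · have h1 : HasDerivAt (fun t => (∫ p in cell a b, f (0, p)) +
        ∫ s in (0 : ℝ)..t, ∫ p in cell a b, g s p) (∫ p in cell a b, g t p) t :=
      ((hF.integral_hasStrictDerivAt 0 t).hasDerivAt).const_add _
    exact h1.hasDerivWithinAt.congr (fun s hs => hftc s hs) (hftc t ht)
  · refine setIntegral_congr_fun hcell fun p hp => ?_
    have hps := cell_subset_slab a b hp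
    rw [hgf ht.le hps,
      ((hasDerivWithinAt_time hf ht.le hps).hasDerivAt (Ici_mem_nhds ht)).deriv]

/-! ### Exponential decay -/

theorem decay_of_hasDerivWithinAt {E F : ℝ → ℝ} {k : ℝ} (hk : 0 < k) (hF : Continuous F)
    (hE0 : ∀ t, 0 ≤ E t) (hE : ∀ t, 0 ≤ t → HasDerivWithinAt E (F t) (Ici 0) t)
    (hle : ∀ t, 0 < t → F t ≤ -k * E t) :
    (∀ t, 0 ≤ t → DifferentiableWithinAt ℝ E (Ici 0) t ∧
      (0 < E t → derivWithin E (Ici 0) t < 0)) ∧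
    (∀ t, 0 ≤ t → E t ≤ E 0 * exp (-k * t)) ∧
    (0 < E 0 → Tendsto (fun t => E t / E 0) atTop (𝓝 0)) := by
  have hcont : ContinuousOn E (Ici 0) := fun t ht => (hE t ht).continuousWithinAt
  -- The equations hold only for t > 0; the inequality at 0 follows by continuity of F and E.
  have hle0 : ∀ t, 0 ≤ t → F t ≤ -k * E t := by
    intro t ht
    rcases ht.eq_or_lt with rfl | ht
    · have h1 : Tendsto F (𝓝[>] 0) (𝓝 (F 0)) := hF.continuousWithinAt
      have h2 : Tendsto (fun t => -k * E t) (𝓝[>] 0) (𝓝 (-k * E 0)) :=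
        (((hcont 0 self_mem_Ici).mono Ioi_subset_Ici_self).tendsto).const_mul _
      exact le_of_tendsto_of_tendsto h1 h2 (eventually_mem_nhdsWithin.mono hle)
    · exact hle t ht
  have hexp : ∀ t, 0 ≤ t → E t ≤ E 0 * exp (-k * t) := by
    have hanti : AntitoneOn (fun t => E t * exp (k * t)) (Ici 0) := by
      have hd : ∀ t, 0 < t → HasDerivAt (fun t => E t * exp (k * t))
          (F t * exp (k * t) + E t * (exp (k * t) * (k * 1))) t := fun t ht =>
        ((hE t ht.le).hasDerivAt (Ici_mem_nhds ht)).mul ((hasDerivAt_id t).const_mul k).exp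
      refine antitoneOn_of_deriv_nonpos (convex_Ici 0)
        (hcont.mul (Continuous.continuousOn (by fun_prop))) ?_ ?_
      · rw [interior_Ici]
        exact fun t ht => (hd t ht).differentiableAt.differentiableWithinAt
      · rw [interior_Ici]
        intro t ht
        rw [(hd t ht).deriv]
        have h1 := hle t ht
        have h2 := exp_pos (k * t)
        nlinarith
    intro t ht
    have h := hanti self_mem_Ici ht ht
    simp only [mul_zero, exp_zero, mul_one] at h
    rw [neg_mul, exp_neg, ← div_eq_mul_inv, le_div_iff₀ (exp_pos _)]
    exact h
  refine ⟨fun t ht => ⟨(hE t ht).differentiableWithinAt, fun hpos => ?_⟩, hexp, fun hpos => ?_⟩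
  · rw [(hE t ht).derivWithin (uniqueDiffOn_Ici 0 t ht)]
    have := hle0 t ht
    nlinarith [mul_pos hk hpos]
  · have hlim : Tendsto (fun t => exp (-k * t)) atTop (𝓝 0) :=
      tendsto_exp_atBot.comp (tendsto_id.const_mul_atTop_of_neg (by linarith))
    refine tendsto_of_tendsto_of_tendsto_of_le_of_le' tendsto_const_nhds hlim
      (Eventually.of_forall fun t => div_nonneg (hE0 t) hpos.le) ?_
    filter_upwards [eventually_ge_atTop 0] with t ht
    rw [div_le_iff₀ hpos, mul_comm]
    exact hexp t ht

/-! ### The energy identity -/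

theorem pd_dot {f g : Pt → Fin 3 → ℝ} {p : Pt} (hf : ∀ i, DifferentiableAt ℝ (fun r => f r i) p)
    (hg : ∀ i, DifferentiableAt ℝ (fun r => g r i) p) (j : Fin 3) :
    pd j (fun r => ∑ i, f r i * g r i) p =
      ∑ i, (f p i * pd j (fun r => g r i) p + pd j (fun r => f r i) p * g p i) := by
  have e : (fun r => ∑ i, f r i * g r i)
      = fun r => f r 0 * g r 0 + f r 1 * g r 1 + f r 2 * g r 2 := by
    ext r
    rw [Fin.sum_univ_three]
  have d : ∀ i, DifferentiableAt ℝ (fun r => f r i * g r i) p := fun i => (hf i).mul (hg i)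
  have d01 : DifferentiableAt ℝ (fun r => f r 0 * g r 0 + f r 1 * g r 1) p := (d 0).add (d 1)
  rw [e, pd_add d01 (d 2), pd_add (d 0) (d 1), pd_mul (hf 0) (hg 0),
    pd_mul (hf 1) (hg 1), pd_mul (hf 2) (hg 2), Fin.sum_univ_three]

theorem contDiffOn_dot {f g : Pt → Fin 3 → ℝ} (hf : ∀ i, ContDiffOn ℝ 1 (fun p => f p i) slab)
    (hg : ∀ i, ContDiffOn ℝ 1 (fun p => g p i) slab) :
    ContDiffOn ℝ 1 (fun p => ∑ i, f p i * g p i) slab :=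
  ContDiffOn.sum fun i _ => (hf i).mul (hg i)

theorem horPeriodicOn_dot {f g : Pt → Fin 3 → ℝ} {s : Set Pt} (hf : HorPeriodicOn a b f s)
    (hg : HorPeriodicOn a b g s) : HorPeriodicOn a b (fun p => ∑ i, f p i * g p i) s :=
  (hf.prodMk hg).comp fun x => ∑ i, x.1 i * x.2 i

/-- The integrand of `production`. -/
noncomputable def productionDensity (m : BasicMotion) (Ha Pm : ℝ) (u h : Pt → Fin 3 → ℝ)
    (p : Pt) : ℝ :=
  -(deriv (m.U Ha) (p 2) * u p 2 * u p 0) + Ha ^ 2 * Pm *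
    (h p 2 * deriv (m.B Ha) (p 2) * u p 0 - u p 2 * deriv (m.B Ha) (p 2) * h p 0
      + h p 2 * deriv (m.U Ha) (p 2) * h p 0)

theorem integral_productionDensity (m : BasicMotion) (Ha Pm : ℝ) {u h : Pt → Fin 3 → ℝ}
    (hu : ∀ i, ContinuousOn (fun p => u p i) slab) (hh : ∀ i, ContinuousOn (fun p => h p i) slab) :
    IntegrableOn (productionDensity m Ha Pm u h) (cell a b) ∧
    ∫ p in cell a b, productionDensity m Ha Pm u h p = production m a b Ha Pm u h := by
  have hU : ContinuousOn (fun p : Pt => deriv (m.U Ha) (p 2)) slab :=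
    (contDiffOn_coord (contDiff_deriv_of_contDiff (m.contDiff_U Ha))).continuousOn
  have hB : ContinuousOn (fun p : Pt => deriv (m.B Ha) (p 2)) slab :=
    (contDiffOn_coord (contDiff_deriv_of_contDiff (m.contDiff_B Ha))).continuousOn
  have i1 : IntegrableOn (fun p => deriv (m.U Ha) (p 2) * u p 2 * u p 0) (cell a b) :=
    integrableOn_cell_of_continuousOn ((hU.mul (hu 2)).mul (hu 0))
  have i2 : IntegrableOn (fun p => h p 2 * deriv (m.B Ha) (p 2) * u p 0) (cell a b) :=
    integrableOn_cell_of_continuousOn (((hh 2).mul hB).mul (hu 0))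
  have i3 : IntegrableOn (fun p => u p 2 * deriv (m.B Ha) (p 2) * h p 0) (cell a b) :=
    integrableOn_cell_of_continuousOn (((hu 2).mul hB).mul (hh 0))
  have i4 : IntegrableOn (fun p => h p 2 * deriv (m.U Ha) (p 2) * h p 0) (cell a b) :=
    integrableOn_cell_of_continuousOn (((hh 2).mul hU).mul (hh 0))
  have i23 := i2.fun_sub i3
  have i := (i23.fun_add i4).const_mul (Ha ^ 2 * Pm)
  refine ⟨i1.fun_neg.fun_add i, ?_⟩
  rw [production, ← integral_neg, ← integral_sub i2 i3, ← integral_add i23 i4,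
    ← integral_const_mul, ← integral_add i1.fun_neg i]
  rfl

/-- The integrated kinetic and magnetic energy balance at one instant: `ut` and `ht` are the time
derivatives of the fields. -/
theorem energy_balance (ha : 0 < a) (hb : 0 < b) (m : BasicMotion) {Ha Pm Re : ℝ}
    {u h ut ht : Pt → Fin 3 → ℝ} {q : Pt → ℝ}
    (hu : ∀ i, ContDiffOn ℝ 2 (fun p => u p i) slab)
    (hh : ∀ i, ContDiffOn ℝ 2 (fun p => h p i) slab) (hq : ContDiffOn ℝ 1 q slab)
    (pu : HorPeriodicOn a b u slab) (ph : HorPeriodicOn a b h slab)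
    (pq : HorPeriodicOn a b q slab)
    (wu : ∀ p : Pt, (p 2 = -1 ∨ p 2 = 1) → u p = 0)
    (wh : ∀ p : Pt, (p 2 = -1 ∨ p 2 = 1) → h p = 0)
    (mom : ∀ p ∈ openSlab, ∀ i : Fin 3,
      ut p i + m.U Ha (p 2) * pd 0 (fun r => u r i) p
          + u p 2 * deriv (m.U Ha) (p 2) * (if i = 0 then 1 else 0)
          + ∑ j, u p j * pd j (fun r => u r i) p
        = Ha ^ 2 * Pm *
            (m.B Ha (p 2) * pd 0 (fun r => h r i) p + pd 2 (fun r => h r i) p / (Pm * Re)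
              + h p 2 * deriv (m.B Ha) (p 2) * (if i = 0 then 1 else 0)
              + ∑ j, h p j * pd j (fun r => h r i) p)
          - pd i q p + lap (fun r => u r i) p / Re)
    (ind : ∀ p ∈ openSlab, ∀ i : Fin 3,
      ht p i + u p 2 * deriv (m.B Ha) (p 2) * (if i = 0 then 1 else 0)
          + m.U Ha (p 2) * pd 0 (fun r => h r i) p
          + ∑ j, u p j * pd j (fun r => h r i) p
          - m.B Ha (p 2) * pd 0 (fun r => u r i) p
          - pd 2 (fun r => u r i) p / (Pm * Re)
          - h p 2 * deriv (m.U Ha) (p 2) * (if i = 0 then 1 else 0)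
          - ∑ j, h p j * pd j (fun r => u r i) p
        = lap (fun r => h r i) p / (Pm * Re))
    (divu : ∀ p ∈ openSlab, ∑ i, pd i (fun r => u r i) p = 0)
    (divh : ∀ p ∈ openSlab, ∑ i, pd i (fun r => h r i) p = 0) :
    ∫ p in cell a b, ((∑ i, u p i * ut p i) + Ha ^ 2 * Pm * ∑ i, h p i * ht p i)
      = production m a b Ha Pm u h
        - (Re⁻¹ * ∑ i, gradSq a b (fun p i j => pd j (fun r => u r i) p) i
          + Ha ^ 2 * Pm * (Pm * Re)⁻¹ *
            ∑ i, gradSq a b (fun p i j => pd j (fun r => h r i) p) i) := by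
  have hu1 : ∀ i, ContDiffOn ℝ 1 (fun p => u p i) slab := fun i => (hu i).of_le (by norm_num)
  have hh1 : ∀ i, ContDiffOn ℝ 1 (fun p => h p i) slab := fun i => (hh i).of_le (by norm_num)
  have wui : ∀ i, ∀ p : Pt, (p 2 = -1 ∨ p 2 = 1) → u p i = 0 := fun i p hp => by simp [wu p hp]
  have whi : ∀ i, ∀ p : Pt, (p 2 = -1 ∨ p 2 = 1) → h p i = 0 := fun i p hp => by simp [wh p hp]
  have cuu := contDiffOn_dot hu1 hu1
  have cuh := contDiffOn_dot hu1 hh1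
  have chh := contDiffOn_dot hh1 hh1
  have puu := horPeriodicOn_dot pu pu
  have puh := horPeriodicOn_dot pu ph
  have phh := horPeriodicOn_dot ph ph
  -- The divergences hidden in the balance. Those with |u|² or |h|² are advection; those with u · h
  -- pair each magnetic force with the matching induction term (`n3`, `n4`, `n5`), which is why the
  -- magnetic energy carries the weight A; `n8` is the pressure, and `g1`, `g2` turn diffusion into
  -- gradients.
  have n1 := (integralNull_coord_mul_pd ha hb (m.contDiff_U Ha) cuu puu).const_mul (-1 / 2)
  have n2 := (integralNull_transport ha hb hu1 pu wu divu cuu puu).const_mul (-1 / 2)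
  have n3 := (integralNull_coord_mul_pd ha hb (m.contDiff_B Ha) cuh puh).const_mul (Ha ^ 2 * Pm)
  have n4 := (integralNull_pd_of_walls ha hb cuh puh (fun p hp => by simp [wu p hp])).const_mul
    (Ha ^ 2 * Pm * (Pm * Re)⁻¹)
  have n5 := (integralNull_transport ha hb hh1 ph wh divh cuh puh).const_mul (Ha ^ 2 * Pm)
  have n6 := (integralNull_coord_mul_pd ha hb (m.contDiff_U Ha) chh phh).const_mul
    (-1 / 2 * (Ha ^ 2 * Pm))
  have n7 := (integralNull_transport ha hb hu1 pu wu divu chh phh).const_mul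
    (-1 / 2 * (Ha ^ 2 * Pm))
  have n8 := (integralNull_transport ha hb hu1 pu wu divu hq pq).const_mul (-1)
  have g1 := fun i => (integralNull_green ha hb (hu i) (pu.comp fun y => y i) (wui i)).const_mul
    Re⁻¹
  have g2 := fun i => (integralNull_green ha hb (hh i) (ph.comp fun y => y i) (whi i)).const_mul
    (Ha ^ 2 * Pm * (Pm * Re)⁻¹)
  have N := ((((((((((n1.add n2).add n3).add n4).add n5).add n6).add n7).add n8).add
    (((g1 0).add (g1 1)).add (g1 2)))).add (((g2 0).add (g2 1)).add (g2 2)))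
  have P := integral_productionDensity (a := a) (b := b) m Ha Pm (fun i => (hu i).continuousOn)
    (fun i => (hh i).continuousOn)
  have iG : ∀ {w : Pt → Fin 3 → ℝ}, (∀ i, ContDiffOn ℝ 1 (fun p => w p i) slab) → ∀ i,
      IntegrableOn (fun p => ∑ j, pd j (fun r => w r i) p ^ 2) (cell a b) := by
    intro w hw i
    refine integrable_finsetSum _ fun j _ => ?_
    refine (integrableOn_cell_of_continuousOn ((continuousOn_pdSlab (hw i) j).pow 2)).congr ?_
    exact (ae_pdSlab_eq_pd a b j _).mono fun p hp => congrArg (· ^ 2) hp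
  have iGs : ∀ {w : Pt → Fin 3 → ℝ}, (∀ i, ContDiffOn ℝ 1 (fun p => w p i) slab) →
      IntegrableOn (fun p => ∑ i, ∑ j, pd j (fun r => w r i) p ^ 2) (cell a b) := fun hw =>
    integrable_finsetSum _ fun i _ => iG hw i
  have eG : ∀ {w : Pt → Fin 3 → ℝ}, (∀ i, ContDiffOn ℝ 1 (fun p => w p i) slab) →
      ∑ i, gradSq a b (fun p i j => pd j (fun r => w r i) p) i =
        ∫ p in cell a b, ∑ i, ∑ j, pd j (fun r => w r i) p ^ 2 := fun hw =>
    (integral_finsetSum _ fun i _ => iG hw i).symm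
  have iu := (iGs hu1).const_mul Re⁻¹
  have ih := (iGs hh1).const_mul (Ha ^ 2 * Pm * (Pm * Re)⁻¹)
  have iuh := iu.fun_add ih
  rw [eG hu1, eG hh1, ← P.2, ← integral_const_mul, ← integral_const_mul, ← integral_add iu ih,
    ← integral_sub P.1 iuh,
    ← add_zero (∫ p in cell a b, (productionDensity m Ha Pm u h p - _)), ← N.2, ← integral_add (P.1.fun_sub iuh) N.1]
  refine integral_congr_ae ((ae_mem_openSlab a b).mono fun p hp => ?_)
  have du : ∀ i, DifferentiableAt ℝ (fun r => u r i) p := fun i =>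
    differentiableAt_of_contDiffOn_slab (hu1 i) hp
  have dh : ∀ i, DifferentiableAt ℝ (fun r => h r i) p := fun i =>
    differentiableAt_of_contDiffOn_slab (hh1 i) hp
  have m0 := mom p hp 0
  have m1 := mom p hp 1
  have m2 := mom p hp 2
  have k0 := ind p hp 0
  have k1 := ind p hp 1
  have k2 := ind p hp 2
  beta_reduce
  simp only [pd_dot du du, pd_dot du dh, pd_dot dh dh, productionDensity]
  simp only [Fin.sum_univ_three, div_eq_mul_inv, Fin.isValue, if_true, one_ne_zero, if_false,
    show (2 : Fin 3) ≠ 0 by decide] at m0 m1 m2 k0 k1 k2 ⊢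
  -- The balance holds for any value of Rm⁻¹; its relation to Re⁻¹ is used only in
  -- `rate_le_of_energy_balance`.
  generalize (Pm * Re)⁻¹ = κ at *
  linear_combination u p 0 * m0 + u p 1 * m1 + u p 2 * m2
    + Ha ^ 2 * Pm * (h p 0 * k0 + h p 1 * k1 + h p 2 * k2)

/-! ### The energy of a disturbance -/

theorem energy_nonneg (a b Ha : ℝ) {Pm : ℝ} (hPm : 0 < Pm) (u h : ℝ → Pt → Fin 3 → ℝ) (t : ℝ) :
    0 ≤ energy a b Ha Pm u h t := by
  have h1 : 0 ≤ ∫ p in cell a b, ∑ i, u t p i ^ 2 :=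
    integral_nonneg fun p => Finset.sum_nonneg fun i _ => sq_nonneg _
  have h2 : 0 ≤ ∫ p in cell a b, ∑ i, h t p i ^ 2 :=
    integral_nonneg fun p => Finset.sum_nonneg fun i _ => sq_nonneg _
  unfold energy
  positivity

theorem contDiffOn_slice {n : ℕ∞ω} {u : ℝ → Pt → Fin 3 → ℝ}
    (hu : ContDiffOn ℝ n (fun s : ℝ × Pt => u s.1 s.2) (Ici (0 : ℝ) ×ˢ slab)) {t : ℝ} (ht : 0 ≤ t)
    (i : Fin 3) : ContDiffOn ℝ n (fun p => u t p i) slab :=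
  (contDiffOn_pi.1 hu i).comp (f := fun p : Pt => (t, p))
    (contDiff_const.prodMk contDiff_id).contDiffOn fun _ hp => ⟨ht, hp⟩

/-- The density of the energy in space-time. -/
noncomputable def energyDensity (Ha Pm : ℝ) (u h : ℝ → Pt → Fin 3 → ℝ) (s : ℝ × Pt) : ℝ :=
  1 / 2 * ((∑ i, u s.1 s.2 i ^ 2) + Ha ^ 2 * Pm * ∑ i, h s.1 s.2 i ^ 2)

theorem contDiffOn_energyDensity {Ha Pm : ℝ} {u h : ℝ → Pt → Fin 3 → ℝ}
    (hu : ContDiffOn ℝ 1 (fun s : ℝ × Pt => u s.1 s.2) (Ici (0 : ℝ) ×ˢ slab))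
    (hh : ContDiffOn ℝ 1 (fun s : ℝ × Pt => h s.1 s.2) (Ici (0 : ℝ) ×ˢ slab)) :
    ContDiffOn ℝ 1 (energyDensity Ha Pm u h) (Ici (0 : ℝ) ×ˢ slab) :=
  contDiffOn_const.mul ((ContDiffOn.sum fun i _ => (contDiffOn_pi.1 hu i).pow 2).add
    (contDiffOn_const.mul (ContDiffOn.sum fun i _ => (contDiffOn_pi.1 hh i).pow 2)))

theorem deriv_energyDensity {Ha Pm : ℝ} {u h : ℝ → Pt → Fin 3 → ℝ}
    (hu : ContDiffOn ℝ 1 (fun s : ℝ × Pt => u s.1 s.2) (Ici (0 : ℝ) ×ˢ slab))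
    (hh : ContDiffOn ℝ 1 (fun s : ℝ × Pt => h s.1 s.2) (Ici (0 : ℝ) ×ˢ slab))
    {t : ℝ} (ht : 0 < t) {p : Pt} (hp : p ∈ slab) :
    deriv (fun s => energyDensity Ha Pm u h (s, p)) t =
      (∑ i, u t p i * deriv (fun s => u s p i) t)
        + Ha ^ 2 * Pm * ∑ i, h t p i * deriv (fun s => h s p i) t := by
  have key : ∀ {w : ℝ → Pt → Fin 3 → ℝ},
      ContDiffOn ℝ 1 (fun s : ℝ × Pt => w s.1 s.2) (Ici (0 : ℝ) ×ˢ slab) → ∀ i,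
      HasDerivAt (fun s => w s p i) (deriv (fun s => w s p i) t) t := fun hw i =>
    (((hasDerivWithinAt_time (contDiffOn_pi.1 hw i) ht.le hp).hasDerivAt
      (Ici_mem_nhds ht)).differentiableAt).hasDerivAt
  have hsum : ∀ {w : ℝ → Pt → Fin 3 → ℝ},
      ContDiffOn ℝ 1 (fun s : ℝ × Pt => w s.1 s.2) (Ici (0 : ℝ) ×ˢ slab) →
      HasDerivAt (fun s => ∑ i, w s p i ^ 2)
        (∑ i, (2 : ℕ) * w t p i ^ (2 - 1) * deriv (fun s => w s p i) t) t := fun hw =>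
    HasDerivAt.fun_sum fun i _ => (key hw i).fun_pow 2
  have h1 : HasDerivAt (fun s => energyDensity Ha Pm u h (s, p)) _ t :=
    ((hsum hu).fun_add ((hsum hh).const_mul (Ha ^ 2 * Pm))).const_mul (1 / 2)
  rw [h1.deriv]
  simp only [Fin.sum_univ_three]
  norm_num
  ring

theorem energy_eq_integral {Ha Pm : ℝ} {u h : ℝ → Pt → Fin 3 → ℝ} {t : ℝ}
    (hu : ∀ i, ContinuousOn (fun p => u t p i) slab)
    (hh : ∀ i, ContinuousOn (fun p => h t p i) slab) :
    energy a b Ha Pm u h t = ∫ p in cell a b, energyDensity Ha Pm u h (t, p) := by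
  have i1 : IntegrableOn (fun p => ∑ i, u t p i ^ 2) (cell a b) :=
    integrable_finsetSum _ fun i _ => integrableOn_cell_of_continuousOn ((hu i).pow 2)
  have i2 : IntegrableOn (fun p => ∑ i, h t p i ^ 2) (cell a b) :=
    integrable_finsetSum _ fun i _ => integrableOn_cell_of_continuousOn ((hh i).pow 2)
  rw [energy, ← integral_const_mul, ← integral_add i1 (i2.const_mul _), ← integral_const_mul]
  rfl

theorem IsAdmissible.integral_sum_sq_le {u : Pt → Fin 3 → ℝ} {G : Pt → Fin 3 → Fin 3 → ℝ}
    (h : IsAdmissible a b u G) :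
    ∫ p in cell a b, ∑ i, u p i ^ 2 ≤ 4 * ∑ i, gradSq a b G i := by
  rw [integral_finsetSum _ fun i _ => (h.memLp i).integrable_sq, Finset.mul_sum]
  exact Finset.sum_le_sum fun i _ => h.integral_sq_le i

/-- The arithmetic of the energy method: index 1 marks the components in D₁, index 2 the spanwise
ones, and `Nu`, `Nh` are the squared norms. -/
theorem rate_le_of_energy_balance {Ha Pm Re Rc D₁u D₁h D₂u D₂h Nu Nh P μ : ℝ} (hPm : 0 < Pm)
    (hRe : 0 < Re) (hlt : Re < Rc) (hD₁u : 0 ≤ D₁u) (hD₁h : 0 ≤ D₁h) (hD₂u : 0 ≤ D₂u)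
    (hD₂h : 0 ≤ D₂h) (hNu : Nu ≤ 4 * (D₁u + D₂u)) (hNh : Nh ≤ 4 * (D₁h + D₂h))
    (hNu0 : 0 ≤ Nu) (hNh0 : 0 ≤ Nh)
    (hP : P ≤ Rc⁻¹ * (D₁u + Ha ^ 2 * D₁h)) (hμ1 : μ ≤ 1) (hμ2 : μ * Pm ≤ 1) :
    P - (Re⁻¹ * (D₁u + D₂u) + Ha ^ 2 * Pm * (Pm * Re)⁻¹ * (D₁h + D₂h)) ≤
      -(μ / 2 * ((Rc - Re) / Rc ^ 2)) * (1 / 2 * (Nu + Ha ^ 2 * Pm * Nh)) := by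
  have hRc : 0 < Rc := hRe.trans hlt
  have e1 : Ha ^ 2 * Pm * (Pm * Re)⁻¹ = Ha ^ 2 * Re⁻¹ := by
    rw [mul_inv]
    field_simp
  set D := (D₁u + D₂u) + Ha ^ 2 * (D₁h + D₂h) with hD
  have hD0 : 0 ≤ D := by positivity
  have h1 : Rc⁻¹ * (D₁u + Ha ^ 2 * D₁h) ≤ Rc⁻¹ * D := by
    refine mul_le_mul_of_nonneg_left ?_ (by positivity)
    have : 0 ≤ Ha ^ 2 * D₂h := by positivity
    rw [hD]
    linarith
  -- The exact gap is (Rc − Re) / (Re Rc); replacing Re by Rc in the denominator leaves a rate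
  -- linear in Rc − Re.
  have h2 : (Rc - Re) / Rc ^ 2 ≤ Re⁻¹ - Rc⁻¹ := by
    rw [inv_sub_inv hRe.ne' hRc.ne']
    refine div_le_div_of_nonneg_left (by linarith) (by positivity) ?_
    nlinarith
  have h3 : 0 ≤ (Rc - Re) / Rc ^ 2 := div_nonneg (by linarith) (by positivity)
  -- The energy weighs the magnetic part by Ha² Pm, the dissipation by Ha² alone; μ Pm ≤ 1 absorbs
  -- the difference.
  have h4 : μ * (Nu + Ha ^ 2 * Pm * Nh) ≤ 4 * D := by
    have a1 : μ * Nu ≤ 1 * Nu := mul_le_mul_of_nonneg_right hμ1 hNu0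
    have a2 : Ha ^ 2 * Nh * (μ * Pm) ≤ Ha ^ 2 * Nh * 1 :=
      mul_le_mul_of_nonneg_left hμ2 (by positivity)
    have a3 : Ha ^ 2 * Nh ≤ Ha ^ 2 * (4 * (D₁h + D₂h)) :=
      mul_le_mul_of_nonneg_left hNh (by positivity)
    rw [hD]
    linarith
  have h5 := mul_le_mul_of_nonneg_right h2 hD0
  have h6 := mul_le_mul_of_nonneg_left h4 h3
  rw [e1]
  have e2 : Re⁻¹ * (D₁u + D₂u) + Ha ^ 2 * Re⁻¹ * (D₁h + D₂h) = Re⁻¹ * D := by rw [hD]; ring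
  rw [e2]
  linarith

theorem IsDisturbance.exists_energy_rate (ha : 0 < a) (hb : 0 < b) {m : BasicMotion}
    {Ha Pm Re : ℝ} (hHa : 0 < Ha) (hPm : 0 < Pm) (hRe : 0 < Re)
    (hlt : Re < criticalRe m a b Ha Pm) {u h : ℝ → Pt → Fin 3 → ℝ} {q : ℝ → Pt → ℝ}
    (H : IsDisturbance m a b Ha Pm Re u h q) :
    ∃ F : ℝ → ℝ, Continuous F ∧
      (∀ t, 0 ≤ t → HasDerivWithinAt (energy a b Ha Pm u h) (F t) (Ici 0) t) ∧
      ∀ t, 0 < t → F t ≤ -(min 1 Pm⁻¹ / 2 * ((criticalRe m a b Ha Pm - Re) /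
        criticalRe m a b Ha Pm ^ 2)) * energy a b Ha Pm u h t := by
  have su := H.smooth_u.of_le (m := 1) (by norm_num)
  have sh := H.smooth_h.of_le (m := 1) (by norm_num)
  have hE : ∀ t, 0 ≤ t → energy a b Ha Pm u h t
      = ∫ p in cell a b, energyDensity Ha Pm u h (t, p) := fun t ht =>
    energy_eq_integral (fun i => (contDiffOn_slice su ht i).continuousOn)
      fun i => (contDiffOn_slice sh ht i).continuousOn
  obtain ⟨F, hF, hder, hval⟩ := exists_hasDerivWithinAt_integral_cell
    (contDiffOn_energyDensity (Ha := Ha) (Pm := Pm) su sh) a b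
  refine ⟨F, hF, fun t ht => (hder t ht).congr (fun s hs => hE s hs) (hE t ht), fun t ht => ?_⟩
  have hu := fun i => contDiffOn_slice H.smooth_u ht.le i
  have hh := fun i => contDiffOn_slice H.smooth_h ht.le i
  have adu := isAdmissible_of_contDiffOn (fun i => contDiffOn_slice su ht.le i)
    (H.periodic_u t ht.le) (H.rigid t ht.le) (H.div_u t ht)
  have adh := isAdmissible_of_contDiffOn (fun i => contDiffOn_slice sh ht.le i)
    (H.periodic_h t ht.le) (H.nonconducting t ht.le) (H.div_h t ht)
  have hFt : F t = ∫ p in cell a b, ((∑ i, u t p i * deriv (fun s => u s p i) t)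
      + Ha ^ 2 * Pm * ∑ i, h t p i * deriv (fun s => h s p i) t) := by
    rw [hval t ht]
    exact setIntegral_congr_fun (isCompact_cell a b).measurableSet fun p hp =>
      deriv_energyDensity su sh ht (cell_subset_slab a b hp)
  have hbal := energy_balance ha hb m (ut := fun p i => deriv (fun s => u s p i) t)
    (ht := fun p i => deriv (fun s => h s p i) t) hu hh (H.smooth_q t ht) (H.periodic_u t ht.le)
    (H.periodic_h t ht.le) (H.periodic_q t ht) (H.rigid t ht.le) (H.nonconducting t ht.le)
    (H.momentum t ht) (H.induction t ht) (H.div_u t ht) (H.div_h t ht)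
  have hP := production_le m ha hb hHa hPm adu adh
  have nu := adu.integral_sum_sq_le
  have nh := adh.integral_sum_sq_le
  rw [hFt, hbal, energy]
  rw [Fin.sum_univ_three] at nu nh ⊢
  rw [Fin.sum_univ_three]
  rw [dissipation₁] at hP
  set Gu := fun (p : Pt) (i j : Fin 3) => pd j (fun r => u t r i) p
  set Gh := fun (p : Pt) (i j : Fin 3) => pd j (fun r => h t r i) p
  have g1 := gradSq_nonneg a b Gu
  have g2 := gradSq_nonneg a b Gh
  rw [show gradSq a b Gu 0 + gradSq a b Gu 1 + gradSq a b Gu 2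
      = (gradSq a b Gu 0 + gradSq a b Gu 2) + gradSq a b Gu 1 by ring] at nu ⊢
  rw [show gradSq a b Gh 0 + gradSq a b Gh 1 + gradSq a b Gh 2
      = (gradSq a b Gh 0 + gradSq a b Gh 2) + gradSq a b Gh 1 by ring] at nh ⊢
  refine rate_le_of_energy_balance hPm hRe hlt (add_nonneg (g1 0) (g1 2))
    (add_nonneg (g2 0) (g2 2)) (g1 1) (g2 1) nu nh
    (integral_nonneg fun p => Finset.sum_nonneg fun i _ => sq_nonneg _)
    (integral_nonneg fun p => Finset.sum_nonneg fun i _ => sq_nonneg _) hP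
    (min_le_left _ _) ?_
  calc min 1 Pm⁻¹ * Pm ≤ Pm⁻¹ * Pm := mul_le_mul_of_nonneg_right (min_le_right _ _) hPm.le
    _ = 1 := inv_mul_cancel₀ hPm.ne'

end

/-! ### Nonlinear stability of both basic motions. -/

theorem theorem3 (a b Ha Pm : ℝ) (ha : 0 < a) (hb : 0 < b) (hHa : 0 < Ha) (hPm : 0 < Pm) :
    (∀ m : BasicMotion,
      0 < criticalRe m a b Ha Pm ∧
      IsLUB (energyRatios m a b Ha Pm) (criticalRe m a b Ha Pm)⁻¹) ∧
    ∃ c₀ : ℝ, 0 < c₀ ∧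
      ∀ (m : BasicMotion) (Re : ℝ), 0 < Re → Re < criticalRe m a b Ha Pm →
        ∀ (u h : ℝ → Pt → Fin 3 → ℝ) (q : ℝ → Pt → ℝ),
          IsDisturbance m a b Ha Pm Re u h q →
          (∀ t, 0 ≤ t →
            DifferentiableWithinAt ℝ (energy a b Ha Pm u h) (Ici 0) t ∧
            (0 < energy a b Ha Pm u h t →
              derivWithin (energy a b Ha Pm u h) (Ici 0) t < 0)) ∧
          (∀ t, 0 ≤ t →
            energy a b Ha Pm u h t ≤
              energy a b Ha Pm u h 0 *
                exp (π ^ 2 / 2 * c₀ * (Re - criticalRe m a b Ha Pm) * t)) ∧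
          (0 < energy a b Ha Pm u h 0 →
            Tendsto (fun t => energy a b Ha Pm u h t / energy a b Ha Pm u h 0) atTop (𝓝 0)) := by
  refine ⟨fun m => energyRatios_bounds m ha hb hHa hPm, ?_⟩
  -- Replacing Re_E² by M² in the denominator weakens the rate but makes the constant common to the
  -- two motions.
  set M := max (criticalRe .couette a b Ha Pm) (criticalRe .hartmann a b Ha Pm) with hM
  have hcpos : ∀ m, 0 < criticalRe m a b Ha Pm := fun m => (energyRatios_bounds m ha hb hHa hPm).1
  have hcle : ∀ m, criticalRe m a b Ha Pm ≤ M := fun m => by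
    cases m
    · exact le_max_left _ _
    · exact le_max_right _ _
  have hM0 : 0 < M := (hcpos .couette).trans_le (hcle _)
  have hmin : 0 < min 1 Pm⁻¹ := lt_min one_pos (inv_pos.2 hPm)
  -- The π² only cancels the one in the stated exponent, since Poincaré is used with constant 4.
  refine ⟨min 1 Pm⁻¹ / (π ^ 2 * M ^ 2), by positivity, fun m Re hRe hlt u h q H => ?_⟩
  obtain ⟨F, hF, hder, hrate⟩ := H.exists_energy_rate ha hb hHa hPm hRe hlt
  have hgap : 0 < criticalRe m a b Ha Pm - Re := sub_pos.2 hlt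
  have hE0 := energy_nonneg a b Ha hPm u h
  set k := min 1 Pm⁻¹ / 2 * ((criticalRe m a b Ha Pm - Re) / M ^ 2) with hk
  have hk0 : 0 < k := by positivity
  have hle : ∀ t, 0 < t → F t ≤ -k * energy a b Ha Pm u h t := fun t ht => by
    refine (hrate t ht).trans (mul_le_mul_of_nonneg_right (neg_le_neg ?_) (hE0 t))
    have := hcpos m
    have := hcle m
    rw [hk]
    gcongr
  have hk' : π ^ 2 / 2 * (min 1 Pm⁻¹ / (π ^ 2 * M ^ 2)) * (Re - criticalRe m a b Ha Pm) = -k := by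
    rw [hk]
    have := pi_pos.ne'
    field_simp
    ring
  rw [hk']
  exact decay_of_hasDerivWithinAt hk0 hF hE0 hder hle
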